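/- Let $K$ be a field. For a finite simple graph $G$ with vertex set $V(G)$ and edge set $E(G)$, let $S_G=K[s_e,t_e : e\in E(G)]$ with the standard grading. For $A\subseteq V(G)$ let $u_A=\prod_{e\in E(G)}\alpha_e$, where $\alpha_e=s_e$ if one vertex of $e$ lies in $A$ and the other does not, and $\alpha_e=t_e$ otherwise. The monomial cut ideal of $G$ is $I(G)=\langle u_A : A\subseteq V(G)\rangle\subseteq S_G$. For a homogeneous ideal $I$ of a standard graded polynomial ring $S$ in finitely many variables over $K$, put $\beta_{ij}(I)=\dim_K \mathrm{Tor}_i^S(I,K)_j$ and $$P_I(x,y)=\sum_{i\ge 0}\sum_{j}\beta_{ij}(I)\,x^iy^j .$$ Let $G_1,\dots,G_r$ be finite simple graphs such that $$|(V(G_1)\cup\cdots\cup V(G_{i-1}))\cap V(G_i)|\le 1\quad\text{for all } i=2,\dots,r,$$ and let $G=G_1\cup\cdots\cup G_r$ (the graph with vertex set $\bigcup_i V(G_i)$ and edge set $\bigcup_i E(G_i)$). Then $$P_{I(G)}(x,y)=P_{I(G_1)}(x,y)\cdots P_{I(G_r)}(x,y).$$ -/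

import Mathlib

noncomputable section

open MvPolynomial

attribute [local instance] MvPolynomial.gradedAlgebra

/-- `v` is a homogeneous element of degree `n` in the graded free module
`⨁_{c ∈ α} S(-deg c)`, where `S` is a standard graded polynomial ring: the component `v c` lies in
`S_{n - deg c}` (so it vanishes if `n < deg c`). -/
def IsHomogVec {σ K α : Type*} [Field K] (deg : α → ℕ) (n : ℕ) (v : α → MvPolynomial σ K) : Prop :=
  ∀ c, ∀ m ∈ (v c).support, m.degree + deg c = n

/-- A graded free resolution
`⋯ → F₂ → F₁ → F₀ → I → 0`
of an ideal `I` of the standard graded polynomial ring `S = K[x_k : k ∈ σ]`, with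
`F_i = ⨁_{b ∈ gen i} S(-deg i b)` of finite rank and all maps homogeneous of degree `0`.
The maps are given by matrices with respect to the chosen bases. -/
structure GradedFreeResolution {σ K : Type*} [Field K] (I : Ideal (MvPolynomial σ K)) where
  /-- the basis of `F_i` -/
  gen : ℕ → Type
  fintypeGen : ∀ i, Fintype (gen i)
  /-- the degrees of the basis elements -/
  deg : ∀ i, gen i → ℕ
  /-- the images in `I` of the basis elements of `F₀` -/
  aug : gen 0 → MvPolynomial σ K
  /-- the matrix of the differential `F_{i+1} → F_i` -/
  d : ∀ i, Matrix (gen i) (gen (i + 1)) (MvPolynomial σ K)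
  aug_homogeneous : ∀ b, (aug b).IsHomogeneous (deg 0 b)
  d_homogeneous : ∀ i b, IsHomogVec (deg i) (deg (i + 1) b) (fun c => d i c b)
  range_aug : LinearMap.range (Fintype.linearCombination (MvPolynomial σ K) aug) = I
  exact_zero : LinearMap.range (d 0).mulVecLin =
    LinearMap.ker (Fintype.linearCombination (MvPolynomial σ K) aug)
  exact_succ : ∀ i, LinearMap.range (d (i + 1)).mulVecLin = LinearMap.ker (d i).mulVecLin

attribute [instance] GradedFreeResolution.fintypeGen

namespace GradedFreeResolution

variable {σ K : Type*} [Field K] {I : Ideal (MvPolynomial σ K)} (F : GradedFreeResolution I)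

/-- The degree `j` part of `F_i ⊗_S K`, where `K = S / (x_k : k ∈ σ)`: the vector space on the basis
elements of `F_i` of degree `j`. -/
abbrev fiber (i j : ℕ) : Type _ := {b : F.gen i // F.deg i b = j} → K

/-- The differential of `F ⊗_S K` in degree `j`: reduce the matrix of `F_{i+1} → F_i` modulo the
variables, that is, take constant coefficients. -/
def fiberD (i j : ℕ) : F.fiber (i + 1) j →ₗ[K] F.fiber i j :=
  Matrix.mulVecLin (Matrix.of fun c b => constantCoeff (F.d i c.1 b.1))

/-- The cycles of `F ⊗_S K` in homological degree `i` and internal degree `j`. -/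
def cycles : ∀ i j : ℕ, Submodule K (F.fiber i j)
  | 0, _ => ⊤
  | i + 1, j => LinearMap.ker (F.fiberD i j)

/-- The boundaries of `F ⊗_S K` in homological degree `i` and internal degree `j`. -/
def boundaries (i j : ℕ) : Submodule K (F.fiber i j) := LinearMap.range (F.fiberD i j)

/-- `Tor_i^S(I, K)_j = H_i(F ⊗_S K)_j`, computed with the graded free resolution `F`. -/
abbrev Tor (i j : ℕ) : Type _ := F.cycles i j ⧸ (F.boundaries i j).submoduleOf (F.cycles i j)

end GradedFreeResolution

/-! ### Existence of graded free resolutions -/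

namespace GradedFreeResolution

variable {σ K : Type*} [Field K]

/-- The homogeneous component of degree `n` of an element of `⨁_{c ∈ α} S(-deg c)`. -/
def vecComponent {α : Type*} (deg : α → ℕ) (n : ℕ) (v : α → MvPolynomial σ K) :
    α → MvPolynomial σ K :=
  fun c => if deg c ≤ n then homogeneousComponent (n - deg c) (v c) else 0

lemma coeff_vecComponent {α : Type*} (deg : α → ℕ) (n : ℕ) (v : α → MvPolynomial σ K) (c : α)
    (m : σ →₀ ℕ) :
    coeff m (vecComponent deg n v c) = if m.degree + deg c = n then coeff m (v c) else 0 := by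
  unfold vecComponent
  by_cases h : deg c ≤ n
  · rw [if_pos h, coeff_homogeneousComponent]
    exact if_congr (by omega) rfl rfl
  · rw [if_neg h, if_neg (by omega), coeff_zero]

lemma isHomogVec_vecComponent {α : Type*} (deg : α → ℕ) (n : ℕ) (v : α → MvPolynomial σ K) :
    IsHomogVec deg n (vecComponent deg n v) := by
  intro c m hm
  rw [mem_support_iff, coeff_vecComponent] at hm
  by_contra h
  exact hm (if_neg h)

lemma vecComponent_of_isHomogVec {α : Type*} (deg : α → ℕ) (n k : ℕ) (v : α → MvPolynomial σ K)
    (hv : IsHomogVec deg k v) : vecComponent deg n v = if k = n then v else 0 := by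
  ext c m
  rw [coeff_vecComponent]
  by_cases hm : coeff m (v c) = 0
  · by_cases hk : k = n <;> simp [hk, hm]
  · rw [hv c m (mem_support_iff.2 hm)]
    by_cases hk : k = n <;> simp [hk]

lemma vecComponent_sum {α ι : Type*} (deg : α → ℕ) (n : ℕ) (s : Finset ι)
    (v : ι → α → MvPolynomial σ K) :
    vecComponent deg n (∑ i ∈ s, v i) = ∑ i ∈ s, vecComponent deg n (v i) := by
  ext c m
  rw [coeff_vecComponent]
  simp only [Finset.sum_apply, coeff_sum, coeff_vecComponent]
  split_ifs <;> simp

lemma exists_sum_vecComponent {α : Type*} [Fintype α] (deg : α → ℕ)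
    (v : α → MvPolynomial σ K) :
    ∃ B : ℕ, ∀ B', B ≤ B' → v = ∑ n ∈ Finset.range B', vecComponent deg n v := by
  refine ⟨∑ c, ((v c).totalDegree + deg c + 1), fun B' hB => ?_⟩
  ext c m
  simp only [Finset.sum_apply, coeff_sum, coeff_vecComponent, Finset.sum_ite_eq,
    Finset.mem_range]
  split_ifs with h
  · rfl
  · by_contra hm
    apply h
    have h1 : m.degree ≤ (v c).totalDegree := le_totalDegree (mem_support_iff.2 hm)
    have h2 : (v c).totalDegree + deg c + 1 ≤ ∑ c, ((v c).totalDegree + deg c + 1) :=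
      Finset.single_le_sum (f := fun c => (v c).totalDegree + deg c + 1)
        (fun _ _ => Nat.zero_le _) (Finset.mem_univ c)
    omega

lemma isHomogVec_mulVec {α β : Type*} [Fintype β] (dα : α → ℕ) (dβ : β → ℕ)
    (A : Matrix α β (MvPolynomial σ K)) (hA : ∀ b, IsHomogVec dα (dβ b) (fun c => A c b))
    (n : ℕ) (v : β → MvPolynomial σ K) (hv : IsHomogVec dβ n v) :
    IsHomogVec dα n (A.mulVec v) := by
  classical
  intro c m hm
  obtain ⟨b, -, hb⟩ := Finset.mem_biUnion.1 (support_sum hm)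
  obtain ⟨m₁, h₁, m₂, h₂, rfl⟩ := Finset.mem_add.1 (support_mul _ _ hb)
  have e₁ := hA b c m₁ h₁
  have e₂ := hv b m₂ h₂
  rw [map_add]
  omega

lemma vecComponent_mulVec {α β : Type*} [Fintype β] (dα : α → ℕ) (dβ : β → ℕ)
    (A : Matrix α β (MvPolynomial σ K)) (hA : ∀ b, IsHomogVec dα (dβ b) (fun c => A c b))
    (n : ℕ) (v : β → MvPolynomial σ K) :
    vecComponent dα n (A.mulVec v) = A.mulVec (vecComponent dβ n v) := by
  obtain ⟨B, hB⟩ := exists_sum_vecComponent dβ v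
  have hv := hB (B + n + 1) (by omega)
  conv_lhs => rw [hv]
  have h1 : A.mulVec (∑ k ∈ Finset.range (B + n + 1), vecComponent dβ k v) =
      ∑ k ∈ Finset.range (B + n + 1), A.mulVec (vecComponent dβ k v) :=
    map_sum A.mulVecLin _ _
  rw [h1, vecComponent_sum]
  have h2 : ∀ k ∈ Finset.range (B + n + 1), vecComponent dα n (A.mulVec (vecComponent dβ k v)) =
      if k = n then A.mulVec (vecComponent dβ k v) else 0 := fun k _ =>
    vecComponent_of_isHomogVec dα n k _
      (isHomogVec_mulVec dα dβ A hA k _ (isHomogVec_vecComponent dβ k v))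
  rw [Finset.sum_congr rfl h2, Finset.sum_ite_eq', if_pos (Finset.mem_range.2 (by omega))]

/-- A graded submodule of a graded free module of finite rank. -/
structure GradedSub (σ K : Type*) [Field K] where
  gen : Type
  fintypeGen : Fintype gen
  deg : gen → ℕ
  sub : Submodule (MvPolynomial σ K) (gen → MvPolynomial σ K)
  component_mem : ∀ v ∈ sub, ∀ n, vecComponent deg n v ∈ sub

attribute [instance] GradedSub.fintypeGen

lemma GradedSub.exists_cover [Finite σ] (N : GradedSub σ K) :
    ∃ (β : Type) (_ : Fintype β) (dβ : β → ℕ) (A : Matrix N.gen β (MvPolynomial σ K)),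
      (∀ b, IsHomogVec N.deg (dβ b) (fun c => A c b)) ∧ LinearMap.range A.mulVecLin = N.sub := by
  obtain ⟨k, s, hs⟩ := Submodule.fg_iff_exists_fin_generating_family.1
    (IsNoetherian.noetherian N.sub)
  choose B hB using fun i => exists_sum_vecComponent N.deg (s i)
  refine ⟨Fin k × Fin (∑ i, B i), inferInstance, fun p => p.2,
    Matrix.of fun c p => vecComponent N.deg p.2 (s p.1) c,
    fun p => isHomogVec_vecComponent N.deg p.2 (s p.1), ?_⟩
  rw [Matrix.range_mulVecLin]
  have hmem : ∀ i, s i ∈ N.sub := fun i => hs ▸ Submodule.subset_span ⟨i, rfl⟩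
  apply le_antisymm
  · rw [Submodule.span_le]
    rintro _ ⟨p, rfl⟩
    exact N.component_mem _ (hmem p.1) p.2
  · rw [← hs, Submodule.span_le]
    rintro _ ⟨i, rfl⟩
    rw [hB i (∑ i, B i) (Finset.single_le_sum (fun _ _ => Nat.zero_le _) (Finset.mem_univ i)),
      Finset.sum_range]
    exact Submodule.sum_mem _ fun n _ => Submodule.subset_span ⟨(i, n), rfl⟩

/-- The relations between finitely many homogeneous generators of a graded submodule. -/
def GradedSub.next [Finite σ] (N : GradedSub σ K) : GradedSub σ K where
  gen := N.exists_cover.choose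
  fintypeGen := N.exists_cover.choose_spec.choose
  deg := N.exists_cover.choose_spec.choose_spec.choose
  sub := letI := N.exists_cover.choose_spec.choose
    LinearMap.ker N.exists_cover.choose_spec.choose_spec.choose_spec.choose.mulVecLin
  component_mem := by
    let _ := N.exists_cover.choose_spec.choose
    have h := N.exists_cover.choose_spec.choose_spec.choose_spec.choose_spec.1
    intro v hv n
    rw [LinearMap.mem_ker, Matrix.mulVecLin_apply] at hv ⊢
    rw [← vecComponent_mulVec _ _ _ h, hv]
    ext c m
    simp [coeff_vecComponent]

/-- The matrix of finitely many homogeneous generators of a graded submodule. -/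
def GradedSub.mat [Finite σ] (N : GradedSub σ K) : Matrix N.gen N.next.gen (MvPolynomial σ K) :=
  N.exists_cover.choose_spec.choose_spec.choose_spec.choose

lemma GradedSub.mat_homogeneous [Finite σ] (N : GradedSub σ K) (b : N.next.gen) :
    IsHomogVec N.deg (N.next.deg b) (fun c => N.mat c b) :=
  N.exists_cover.choose_spec.choose_spec.choose_spec.choose_spec.1 b

lemma GradedSub.range_mat [Finite σ] (N : GradedSub σ K) :
    LinearMap.range N.mat.mulVecLin = N.sub :=
  N.exists_cover.choose_spec.choose_spec.choose_spec.choose_spec.2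

lemma GradedSub.ker_mat [Finite σ] (N : GradedSub σ K) :
    LinearMap.ker N.mat.mulVecLin = N.next.sub := rfl

/-- A homogeneous ideal as a graded submodule of the free module of rank one. -/
def GradedSub.ofIdeal (I : Ideal (MvPolynomial σ K))
    (hI : I.IsHomogeneous (homogeneousSubmodule σ K)) : GradedSub σ K where
  gen := Unit
  fintypeGen := inferInstance
  deg := fun _ => 0
  sub := Submodule.comap (LinearMap.proj ()) I
  component_mem := by
    intro v hv n
    have h := (mem_iff_homogeneousComponent_mem hI (v ())).1 hv n
    rw [Submodule.mem_comap, LinearMap.proj_apply]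
    simpa [vecComponent] using h

/-- Every homogeneous ideal of a polynomial ring in finitely many variables over a field has a
graded free resolution. -/
theorem nonempty_of_isHomogeneous [Finite σ] (I : Ideal (MvPolynomial σ K))
    (hI : I.IsHomogeneous (homogeneousSubmodule σ K)) : Nonempty (GradedFreeResolution I) := by
  let N : ℕ → GradedSub σ K := fun n =>
    Nat.rec (GradedSub.ofIdeal I hI) (fun _ M => M.next) n
  have key : ∀ v, Fintype.linearCombination (MvPolynomial σ K) (fun b => (N 0).mat () b) v =
      (N 0).mat.mulVecLin v () := by
    intro v
    rw [Fintype.linearCombination_apply, Matrix.mulVecLin_apply]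
    exact Finset.sum_congr rfl fun b _ => mul_comm _ _
  have hker : LinearMap.ker (Fintype.linearCombination (MvPolynomial σ K)
      (fun b => (N 0).mat () b)) = LinearMap.ker (N 0).mat.mulVecLin := by
    ext v
    rw [LinearMap.mem_ker, LinearMap.mem_ker, key v]
    exact ⟨fun h => funext fun _ => h, fun h => congrFun h ()⟩
  refine ⟨{
    gen := fun i => (N (i + 1)).gen
    fintypeGen := fun i => (N (i + 1)).fintypeGen
    deg := fun i => (N (i + 1)).deg
    aug := fun b => (N 0).mat () b
    d := fun i => (N (i + 1)).mat
    aug_homogeneous := ?_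
    d_homogeneous := fun i b => (N (i + 1)).mat_homogeneous b
    range_aug := ?_
    exact_zero := ?_
    exact_succ := fun i => (N (i + 1 + 1)).range_mat }⟩
  · intro b m hm
    have h := (N 0).mat_homogeneous b () m (mem_support_iff.2 hm)
    exact (congrArg (fun f => f m) Finsupp.degree_eq_weight_one).symm.trans h
  · ext x
    constructor
    · rintro ⟨v, rfl⟩
      rw [key v]
      have h : (N 0).mat.mulVecLin v ∈ (N 0).sub := (N 0).range_mat ▸ ⟨v, rfl⟩
      exact h
    · intro hx
      have h : (fun _ => x) ∈ (N 0).sub := hx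
      rw [← (N 0).range_mat] at h
      obtain ⟨v, hv⟩ := h
      exact ⟨v, (key v).trans (congrFun hv ())⟩
  · exact (N 1).range_mat.trans hker.symm

end GradedFreeResolution

/-! ### Graded Betti numbers -/

/-- The graded Betti number `β_{ij}(I) = dim_K Tor_i^S(I, K)_j` of a homogeneous ideal `I` of the
standard graded polynomial ring `S = K[x_k : k ∈ σ]`. As usual, `Tor` is computed with some graded
free resolution of `I`; up to isomorphism it does not depend on the choice. -/
def gradedBetti {σ K : Type*} [Finite σ] [Field K] (I : Ideal (MvPolynomial σ K))
    (hI : I.IsHomogeneous (homogeneousSubmodule σ K)) (i j : ℕ) : ℕ :=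
  Module.finrank K ((GradedFreeResolution.nonempty_of_isHomogeneous I hI).some.Tor i j)

/-- `P_I(x, y) = ∑_{i,j} β_{ij}(I) x^i y^j`, as a formal sum: `x` is the variable `0`, `y` is the
variable `1`, and the coefficient of `x^i y^j` is `β_{ij}(I)`. (The Betti numbers `β_{ij}(I)` with
`j < 0` vanish, since an ideal lives in nonnegative degrees.) -/
def bettiSeries {σ K : Type*} [Finite σ] [Field K] (I : Ideal (MvPolynomial σ K))
    (hI : I.IsHomogeneous (homogeneousSubmodule σ K)) : MvPowerSeries (Fin 2) ℤ :=
  fun m => (gradedBetti I hI (m 0) (m 1) : ℤ)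

/-! ### Cut ideals -/

/-- The cut monomial `u_A` in the polynomial ring with variables `s_e = X (inl e)` and
`t_e = X (inr e)`, one pair for each edge `e` of `G`: the product over the edges of `s_e` if `e` has
one vertex in `A` and the other outside of `A`, and of `t_e` otherwise. -/
def cutMonomial (K : Type*) [Field K] {V : Type*} (G : SimpleGraph V) (A : Set V) :
    MvPolynomial (G.edgeSet ⊕ G.edgeSet) K :=
  open Classical in
  ∏ᶠ e : G.edgeSet,
    if (∃ v ∈ e.1, v ∈ A) ∧ (∃ w ∈ e.1, w ∉ A) then X (Sum.inl e) else X (Sum.inr e)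

/-- The monomial cut ideal `I(G)`, generated by all cut monomials. -/
def cutIdeal (K : Type*) [Field K] {V : Type*} (G : SimpleGraph V) :
    Ideal (MvPolynomial (G.edgeSet ⊕ G.edgeSet) K) :=
  Ideal.span (Set.range fun A : Set V => cutMonomial K G A)

theorem cutIdeal_isHomogeneous (K : Type*) [Field K] {V : Type*} [Finite V] (G : SimpleGraph V) :
    (cutIdeal K G).IsHomogeneous (homogeneousSubmodule (G.edgeSet ⊕ G.edgeSet) K) := by
  classical
  have := Fintype.ofFinite G.edgeSet
  apply Ideal.homogeneous_span
  rintro _ ⟨A, rfl⟩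
  refine ⟨∑ _e : G.edgeSet, 1, ?_⟩
  rw [mem_homogeneousSubmodule]
  simp only [cutMonomial]
  rw [finprod_eq_prod_of_fintype]
  apply IsHomogeneous.prod
  intro e _
  split_ifs <;> exact isHomogeneous_X _ _

/-- The graded Betti polynomial `P_{I(G)}(x, y)` of the monomial cut ideal of a finite graph. -/
def cutBettiSeries (K : Type*) [Field K] {V : Type*} [Finite V] (G : SimpleGraph V) :
    MvPowerSeries (Fin 2) ℤ :=
  bettiSeries (cutIdeal K G) (cutIdeal_isHomogeneous K G)

end

/-! Glue two graphs `A` and `B` along at most one vertex. They share no edge, so the polynomial ring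
of the union is the tensor product over `K` of the two polynomial rings. A vertex set and its
complement define the same cut, so a cut of `A` and a cut of `B` can always be chosen to agree at
the common vertex and then come from one cut of the union. Conversely every cut restricts. Hence the
cut monomials of the union are exactly the products of a cut monomial of `A` and one of `B`, and the
cut ideal of the union is the product of the extensions of the two cut ideals, which live in
disjoint sets of variables (`cutBettiSeries_eq_mul`). Induction on the number of pieces then reduces
the theorem to `bettiSeries_mul`.

For ideals in disjoint sets of variables the Betti series multiply because the tensor product over
`K` of minimal resolutions is a minimal resolution of the product ideal (`TotalResolution.tensor`).
Exactness is a question about complexes of vector spaces, and these split, so a contracting homotopy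
can be written down (`AugmentedComplex.tensorD_exact`). Minimality persists because the entries of
the new differential are, up to sign, 0 or entries of the old ones. The generators are pairs of
generators, and bidegrees add.

Betti numbers are defined through an arbitrary chosen resolution, so they must be compared with a
minimal one: any two resolutions are homotopy equivalent, and modulo the variables the differential
of a minimal one vanishes. Thus Betti numbers count minimal generators (`finrank_tor_eq_card`). -/

noncomputable section

open MvPolynomial

attribute [local instance] MvPolynomial.gradedAlgebra

open scoped TensorProduct

/-! ### Comparison of graded free resolutions. -/

namespace GradedFreeResolution

variable {σ K : Type*} [Field K]

/-- The matrix of a homomorphism of degree `0` between graded free modules. -/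
def IsHomogMat {α β : Type*} (dα : α → ℕ) (dβ : β → ℕ) (A : Matrix α β (MvPolynomial σ K)) : Prop :=
  ∀ b, IsHomogVec dα (dβ b) (fun c => A c b)

section IsHomogMat

variable {α β γ : Type*} {dα : α → ℕ} {dβ : β → ℕ} {dγ : γ → ℕ}

lemma IsHomogMat.mul [Fintype β] {A : Matrix α β (MvPolynomial σ K)}
    {B : Matrix β γ (MvPolynomial σ K)} (hA : IsHomogMat dα dβ A) (hB : IsHomogMat dβ dγ B) :
    IsHomogMat dα dγ (A * B) :=
  fun b => isHomogVec_mulVec dα dβ A hA _ _ (hB b)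

lemma IsHomogMat.sub {A B : Matrix α β (MvPolynomial σ K)} (hA : IsHomogMat dα dβ A)
    (hB : IsHomogMat dα dβ B) : IsHomogMat dα dβ (A - B) := by
  intro b c m hm
  by_cases h : m ∈ (A c b).support
  · exact hA b c m h
  · refine hB b c m ?_
    have e : coeff m ((A - B) c b) = coeff m (A c b) - coeff m (B c b) := coeff_sub σ m _ _
    rw [notMem_support_iff.1 h, zero_sub] at e
    exact mem_support_iff.2 fun h' => mem_support_iff.1 hm (e.trans (by rw [h', neg_zero]))

lemma IsHomogMat.one [DecidableEq α] :
    IsHomogMat dα dα (1 : Matrix α α (MvPolynomial σ K)) := by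
  intro b c m hm
  change m ∈ ((1 : Matrix α α (MvPolynomial σ K)) c b).support at hm
  by_cases h : c = b
  · subst h
    classical
    rw [Matrix.one_apply_eq, mem_support_iff, coeff_one] at hm
    have h0 : 0 = m := by by_contra h; exact hm (if_neg h)
    simp [← h0]
  · simp [Matrix.one_apply_ne h] at hm

/-- Projectivity of graded free modules: each column is lifted separately, and the component of the
right degree of a lift is again a lift. -/
lemma IsHomogMat.exists_mul_eq [Fintype β] [Fintype γ] {A : Matrix α β (MvPolynomial σ K)}
    {B : Matrix α γ (MvPolynomial σ K)} (hA : IsHomogMat dα dβ A) (hB : IsHomogMat dα dγ B)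
    (h : LinearMap.range B.mulVecLin ≤ LinearMap.range A.mulVecLin) :
    ∃ C : Matrix β γ (MvPolynomial σ K), IsHomogMat dβ dγ C ∧ A * C = B := by
  classical
  have hcol : ∀ b, ∃ v, A.mulVec v = fun c => B c b := fun b => by
    obtain ⟨v, hv⟩ := h ⟨Pi.single b 1, rfl⟩
    exact ⟨v, hv.trans (B.mulVec_single_one b)⟩
  choose v hv using hcol
  refine ⟨Matrix.of fun c b => vecComponent dβ (dγ b) (v b) c,
    fun b => isHomogVec_vecComponent _ _ _, ?_⟩
  ext1 c b
  change A.mulVec (vecComponent dβ (dγ b) (v b)) c = _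
  rw [← vecComponent_mulVec dα dβ A hA, hv, vecComponent_of_isHomogVec _ _ _ _ (hB b), if_pos rfl]

/-- The degree `j` part of the reduction of a matrix modulo the variables. -/
def reduction (dα : α → ℕ) (dβ : β → ℕ) (j : ℕ) (A : Matrix α β (MvPolynomial σ K)) :
    Matrix {c // dα c = j} {b // dβ b = j} K :=
  Matrix.of fun c b => constantCoeff (A c.1 b.1)

/-- An entry with nonzero constant term joins basis elements of equal degree, so only the
intermediate indices of degree `j` contribute. -/
lemma reduction_mul [Fintype β] {A : Matrix α β (MvPolynomial σ K)}
    (hA : IsHomogMat dα dβ A) (B : Matrix β γ (MvPolynomial σ K)) (j : ℕ) :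
    reduction dα dγ j (A * B) = reduction dα dβ j A * reduction dβ dγ j B := by
  classical
  ext c a
  simp only [reduction, Matrix.of_apply, Matrix.mul_apply, map_sum, map_mul]
  rw [← Finset.sum_subset (Finset.subset_univ (Finset.univ.filter fun b => dβ b = j)),
    Finset.sum_subtype (p := fun b => dβ b = j) _ (by simp)]
  intro b _ hb
  have : constantCoeff (A c b) = 0 := by
    by_contra h
    have := hA b c 0 (mem_support_iff.2 h)
    have := c.2
    simp_all
  rw [this, zero_mul]

lemma reduction_sub (A B : Matrix α β (MvPolynomial σ K)) (j : ℕ) :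
    reduction dα dβ j (A - B) = reduction dα dβ j A - reduction dα dβ j B := by
  ext; simp [reduction]

lemma reduction_one [DecidableEq α] (j : ℕ) :
    reduction dα dα j (1 : Matrix α α (MvPolynomial σ K)) = 1 := by
  ext a b
  by_cases h : a = b
  · subst h; simp [reduction]
  · simp [reduction, Matrix.one_apply_ne h, Matrix.one_apply_ne (Subtype.coe_injective.ne h)]

end IsHomogMat

/-- Serves recursive constructions of chain maps, homotopies and resolutions. Whatever invariant
makes the next step possible is packed into `X i`. -/
lemma exists_dependent_sequence {X : ℕ → Type*} (R : ∀ i, X i → X (i + 1) → Prop) (x₀ : X 0)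
    (h : ∀ i x, ∃ y, R i x y) : ∃ f : ∀ i, X i, f 0 = x₀ ∧ ∀ i, R i (f i) (f (i + 1)) := by
  choose g hg using h
  exact ⟨fun i => Nat.rec x₀ g i, rfl, fun i => hg i _⟩

variable {I : Ideal (MvPolynomial σ K)}

/-- The augmentation as a matrix with one row. -/
def augMat (F : GradedFreeResolution I) : Matrix Unit (F.gen 0) (MvPolynomial σ K) :=
  Matrix.of fun _ b => F.aug b

lemma augMat_mulVec (F : GradedFreeResolution I) (v : F.gen 0 → MvPolynomial σ K) :
    F.augMat.mulVec v = fun _ => Fintype.linearCombination (MvPolynomial σ K) F.aug v := by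
  ext1 u
  rw [Fintype.linearCombination_apply]
  exact Finset.sum_congr rfl fun b _ => mul_comm _ _

lemma isHomogMat_augMat (F : GradedFreeResolution I) :
    IsHomogMat (fun _ => 0) (F.deg 0) F.augMat := by
  intro b _ m hm
  have h := F.aug_homogeneous b (mem_support_iff.1 hm)
  rw [← h, Finsupp.degree_eq_weight_one]
  rfl

lemma isHomogMat_d (F : GradedFreeResolution I) (i : ℕ) :
    IsHomogMat (F.deg i) (F.deg (i + 1)) (F.d i) := F.d_homogeneous i

lemma mem_range_augMat (F : GradedFreeResolution I) (v : Unit → MvPolynomial σ K) :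
    v ∈ LinearMap.range F.augMat.mulVecLin ↔ v () ∈ I := by
  conv_rhs => rw [← F.range_aug]
  constructor
  · rintro ⟨w, rfl⟩
    exact ⟨w, (congrFun (F.augMat_mulVec w) ()).symm⟩
  · rintro ⟨w, hw⟩
    exact ⟨w, (F.augMat_mulVec w).trans (funext fun _ => hw)⟩

lemma ker_augMat (F : GradedFreeResolution I) :
    LinearMap.ker F.augMat.mulVecLin = LinearMap.range (F.d 0).mulVecLin := by
  rw [F.exact_zero]
  ext v
  rw [LinearMap.mem_ker, LinearMap.mem_ker, Matrix.mulVecLin_apply, augMat_mulVec]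
  exact ⟨fun h => congrFun h (), fun h => funext fun _ => h⟩

lemma mul_eq_zero_iff_range_le {α β γ : Type*} [Fintype β] [Fintype γ]
    {A : Matrix α β (MvPolynomial σ K)} {B : Matrix β γ (MvPolynomial σ K)} :
    A * B = 0 ↔ LinearMap.range B.mulVecLin ≤ LinearMap.ker A.mulVecLin := by
  classical
  rw [LinearMap.range_le_ker_iff, ← Matrix.mulVecLin_mul]
  constructor
  · intro h; rw [h, Matrix.mulVecLin_zero]
  · intro h
    ext1 c b
    exact congrFun (((A * B).mulVec_single_one b).symm.trans
      (LinearMap.congr_fun h (Pi.single b 1))) c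

lemma augMat_mul_d (F : GradedFreeResolution I) : F.augMat * F.d 0 = 0 :=
  mul_eq_zero_iff_range_le.2 F.ker_augMat.ge

lemma d_mul_d (F : GradedFreeResolution I) (i : ℕ) : F.d i * F.d (i + 1) = 0 :=
  mul_eq_zero_iff_range_le.2 (F.exact_succ i).le

/-- Comparison theorem: the identity of `I` lifts degree by degree, since the source is graded free
and the target is exact. -/
lemma exists_chainMap (F F' : GradedFreeResolution I) :
    ∃ f : ∀ i, Matrix (F'.gen i) (F.gen i) (MvPolynomial σ K),
      (∀ i, IsHomogMat (F'.deg i) (F.deg i) (f i)) ∧ F'.augMat * f 0 = F.augMat ∧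
      ∀ i, F'.d i * f (i + 1) = f i * F.d i := by
  obtain ⟨f₀, hf₀, h₀⟩ := F'.isHomogMat_augMat.exists_mul_eq F.isHomogMat_augMat
    (fun v hv => (F'.mem_range_augMat v).2 ((F.mem_range_augMat v).1 hv))
  -- The range condition is the invariant: it allows `f * F.d i` to be lifted through `F'.d i`.
  let X : ℕ → Type _ := fun i => {f : Matrix (F'.gen i) (F.gen i) (MvPolynomial σ K) //
    IsHomogMat (F'.deg i) (F.deg i) f ∧
    LinearMap.range (f * F.d i).mulVecLin ≤ LinearMap.range (F'.d i).mulVecLin}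
  let x₀ : X 0 := ⟨f₀, hf₀, by
    rw [← F'.ker_augMat, ← mul_eq_zero_iff_range_le, ← Matrix.mul_assoc, h₀, augMat_mul_d]⟩
  obtain ⟨f, hf, hR⟩ := exists_dependent_sequence (X := X)
    (fun i x y => F'.d i * y.1 = x.1 * F.d i) x₀ (by
      rintro i ⟨f, hf, hr⟩
      obtain ⟨C, hC, hCe⟩ := (F'.isHomogMat_d i).exists_mul_eq (hf.mul (F.isHomogMat_d i)) hr
      refine ⟨⟨C, hC, ?_⟩, hCe⟩
      rw [F'.exact_succ, ← mul_eq_zero_iff_range_le, ← Matrix.mul_assoc, hCe, Matrix.mul_assoc,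
        d_mul_d, Matrix.mul_zero])
  exact ⟨fun i => (f i).1, fun i => (f i).2.1,
    (congrArg (fun x : X 0 => F'.augMat * x.1) hf).trans h₀, hR⟩

-- Uniqueness of lifts up to homotopy, for lifts of the identity of `I`: at each stage the error
-- that remains has its columns in the kernel of the differential, so exactness provides the next
-- piece of the homotopy.
open scoped Classical in
lemma exists_homotopy (F : GradedFreeResolution I)
    (φ : ∀ i, Matrix (F.gen i) (F.gen i) (MvPolynomial σ K))
    (hφ : ∀ i, IsHomogMat (F.deg i) (F.deg i) (φ i)) (h₀ : F.augMat * φ 0 = F.augMat)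
    (hd : ∀ i, F.d i * φ (i + 1) = φ i * F.d i) :
    ∃ h : ∀ i, Matrix (F.gen (i + 1)) (F.gen i) (MvPolynomial σ K),
      (∀ i, IsHomogMat (F.deg (i + 1)) (F.deg i) (h i)) ∧ F.d 0 * h 0 = 1 - φ 0 ∧
      ∀ i, F.d (i + 1) * h (i + 1) = 1 - φ (i + 1) - h i * F.d i := by
  obtain ⟨k₀, hk₀, e₀⟩ := (F.isHomogMat_d 0).exists_mul_eq (IsHomogMat.one.sub (hφ 0)) (by
    rw [← F.ker_augMat, ← mul_eq_zero_iff_range_le, Matrix.mul_sub, h₀, Matrix.mul_one, sub_self])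
  -- The equation is the invariant: the error left in degree `i + 1` consists of cycles.
  let X : ℕ → Type _ := fun i => {h : Matrix (F.gen (i + 1)) (F.gen i) (MvPolynomial σ K) //
    IsHomogMat (F.deg (i + 1)) (F.deg i) h ∧ F.d i * (1 - φ (i + 1) - h * F.d i) = 0}
  let x₀ : X 0 := ⟨k₀, hk₀, by
    rw [Matrix.mul_sub, ← Matrix.mul_assoc, e₀, Matrix.mul_sub, hd, Matrix.sub_mul,
      Matrix.mul_one, Matrix.one_mul, sub_self]⟩
  obtain ⟨f, hf, hR⟩ := exists_dependent_sequence (X := X)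
    (fun i x y => F.d (i + 1) * y.1 = 1 - φ (i + 1) - x.1 * F.d i) x₀ (by
      rintro i ⟨k, hk, hr⟩
      obtain ⟨C, hC, hCe⟩ := (F.isHomogMat_d (i + 1)).exists_mul_eq
        ((IsHomogMat.one.sub (hφ (i + 1))).sub (hk.mul (F.isHomogMat_d i)))
        (by rw [F.exact_succ]; exact mul_eq_zero_iff_range_le.1 hr)
      refine ⟨⟨C, hC, ?_⟩, hCe⟩
      rw [Matrix.mul_sub, ← Matrix.mul_assoc, hCe, Matrix.mul_sub, hd, Matrix.sub_mul,
        Matrix.sub_mul, Matrix.mul_assoc k, d_mul_d, Matrix.mul_one, Matrix.one_mul,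
        Matrix.mul_zero, sub_zero, sub_self])
  exact ⟨fun i => (f i).1, fun i => (f i).2.1,
    (congrArg (fun x : X 0 => F.d 0 * x.1) hf).trans e₀, hR⟩

/-- A graded free resolution is minimal if its differentials vanish modulo the variables. -/
def IsMinimal (F : GradedFreeResolution I) : Prop :=
  ∀ i c b, constantCoeff (F.d i c b) = 0

lemma IsMinimal.reduction_d {F : GradedFreeResolution I} (hF : F.IsMinimal) (i j : ℕ) :
    reduction (F.deg i) (F.deg (i + 1)) j (F.d i) = 0 := by
  ext c b
  exact hF i c b

/-- The Betti numbers computed with any resolution are the numbers of generators of a minimal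
one. -/
theorem finrank_tor_eq_card {F F' : GradedFreeResolution I} (hF : F.IsMinimal) (i j : ℕ) :
    Module.finrank K (F'.Tor i j) = Nat.card {b : F.gen i // F.deg i b = j} := by
  classical
  obtain ⟨f, hf, f₀, fd⟩ := exists_chainMap F F'
  obtain ⟨g, hg, g₀, gd⟩ := exists_chainMap F' F
  obtain ⟨h, hh, h₀, hd⟩ := F.exists_homotopy (fun i => g i * f i) (fun i => (hg i).mul (hf i))
    (by rw [← Matrix.mul_assoc, g₀, f₀])
    (fun i => by rw [← Matrix.mul_assoc, gd, Matrix.mul_assoc, fd, Matrix.mul_assoc])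
  obtain ⟨k, hk, k₀, kd⟩ := F'.exists_homotopy (fun i => f i * g i) (fun i => (hf i).mul (hg i))
    (by rw [← Matrix.mul_assoc, f₀, g₀])
    (fun i => by rw [← Matrix.mul_assoc, fd, Matrix.mul_assoc, gd, Matrix.mul_assoc])
  let fr := reduction (F'.deg i) (F.deg i) j (f i)
  let gr := reduction (F.deg i) (F'.deg i) j (g i)
  -- Every term of the homotopy contains a differential of the minimal resolution `F`, which reduces
  -- to zero.
  have hgf : gr * fr = 1 := by
    have e : reduction (F.deg i) (F.deg i) j (1 - g i * f i) = 0 := by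
      cases i with
      | zero => rw [← h₀, reduction_mul (F.isHomogMat_d 0), hF.reduction_d, Matrix.zero_mul]
      | succ i =>
        have e := congrArg (reduction (F.deg (i + 1)) (F.deg (i + 1)) j) (hd i)
        rw [reduction_mul (F.isHomogMat_d _), hF.reduction_d, Matrix.zero_mul, reduction_sub,
          reduction_mul (hh i), hF.reduction_d, Matrix.mul_zero, sub_zero] at e
        exact e.symm
    rw [reduction_sub, reduction_one, reduction_mul (hg i), sub_eq_zero] at e
    exact e.symm
  have hcyc : ∀ v, fr.mulVecLin v ∈ F'.cycles i j := by
    intro v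
    cases i with
    | zero => trivial
    | succ i =>
      have e := congrArg (reduction (F'.deg i) (F.deg (i + 1)) j) (fd i)
      rw [reduction_mul (F'.isHomogMat_d _), reduction_mul (hf i), hF.reduction_d,
        Matrix.mul_zero] at e
      change (reduction _ _ j (F'.d i)).mulVec (fr.mulVec v) = 0
      rw [Matrix.mulVec_mulVec, e, Matrix.zero_mulVec]
  -- Here `F'` need not be minimal, so the homotopy gives the identity only up to a boundary.
  have hfg : ∀ w ∈ F'.cycles i j, w - fr.mulVec (gr.mulVec w) ∈ F'.boundaries i j := by
    intro w hw
    have e : w - fr.mulVec (gr.mulVec w) =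
        (reduction (F'.deg i) (F'.deg i) j (1 - f i * g i)).mulVec w := by
      rw [reduction_sub, reduction_one, reduction_mul (hf i), Matrix.sub_mulVec,
        Matrix.one_mulVec, Matrix.mulVec_mulVec]
    rw [e]
    cases i with
    | zero =>
      rw [← k₀, reduction_mul (F'.isHomogMat_d 0), ← Matrix.mulVec_mulVec]
      exact ⟨_, rfl⟩
    | succ i =>
      have hw' : (reduction _ _ j (F'.d i)).mulVec w = 0 := hw
      have e := congrArg (reduction (F'.deg (i + 1)) (F'.deg (i + 1)) j) (kd i)
      rw [reduction_mul (F'.isHomogMat_d _), reduction_sub, reduction_mul (hk i)] at e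
      have e' := congrArg (fun M => Matrix.mulVec M w) (eq_add_of_sub_eq e.symm)
      simp only [Matrix.add_mulVec, ← Matrix.mulVec_mulVec, hw', Matrix.mulVec_zero,
        add_zero] at e'
      exact ⟨_, e'.symm⟩
  -- Applying `gr` turns a boundary of `F'` into a boundary of the reduction of `F`, where all
  -- boundaries are zero.
  have hb : ∀ v, fr.mulVec v ∈ F'.boundaries i j → v = 0 := by
    rintro v ⟨u, hu⟩
    have hu' : (reduction _ _ j (F'.d i)).mulVec u = fr.mulVec v := hu
    have e := congrArg (reduction (F.deg i) (F'.deg (i + 1)) j) (gd i)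
    rw [reduction_mul (F.isHomogMat_d _), hF.reduction_d, Matrix.zero_mul,
      reduction_mul (hg i)] at e
    have := congrArg gr.mulVec hu'
    rwa [Matrix.mulVec_mulVec, ← e, Matrix.mulVec_mulVec, hgf, Matrix.one_mulVec,
      Matrix.zero_mulVec, eq_comm] at this
  let Φ : F.fiber i j →ₗ[K] F'.Tor i j :=
    ((F'.boundaries i j).submoduleOf (F'.cycles i j)).mkQ ∘ₗ
      LinearMap.codRestrict (F'.cycles i j) fr.mulVecLin hcyc
  have hΦ : Function.Bijective Φ := by
    constructor
    · rw [injective_iff_map_eq_zero]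
      intro v hv
      have hv' : Submodule.Quotient.mk (p := (F'.boundaries i j).submoduleOf (F'.cycles i j))
        ⟨fr.mulVec v, hcyc v⟩ = 0 := hv
      have hm := (Submodule.Quotient.mk_eq_zero _).1 hv'
      exact hb v hm
    · intro y
      obtain ⟨⟨w, hw⟩, rfl⟩ := Submodule.Quotient.mk_surjective _ y
      refine ⟨gr.mulVec w, ?_⟩
      rw [eq_comm]
      exact (Submodule.Quotient.eq _).2 (hfg w hw)
  rw [← (LinearEquiv.ofBijective Φ hΦ).finrank_eq, Module.finrank_pi, Nat.card_eq_fintype_card]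

end GradedFreeResolution

/-! ### Existence of minimal resolutions. -/

namespace GradedFreeResolution

variable {σ K : Type*} [Field K]

/-- If a relation between the columns of a homogeneous matrix has a nonzero constant term, then one
of the columns is redundant. -/
lemma range_submatrix_of_constantCoeff_ne_zero {α β : Type*} [Fintype β] {dα : α → ℕ} {dβ : β → ℕ}
    {A : Matrix α β (MvPolynomial σ K)} (hA : IsHomogMat dα dβ A) {v : β → MvPolynomial σ K}
    (hv : A.mulVec v = 0) {b : β} (hb : constantCoeff (v b) ≠ 0) [Fintype {b' // b' ≠ b}] :
    LinearMap.range (A.submatrix id (Subtype.val : {b' // b' ≠ b} → β)).mulVecLin =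
      LinearMap.range A.mulVecLin := by
  classical
  -- In this degree the coefficient of the relation at `b` is a nonzero constant, so the relation
  -- can be solved for column `b`.
  set w := vecComponent dβ (dβ b) v with hw
  have hAw : A.mulVec w = 0 := by
    rw [hw, ← vecComponent_mulVec dα dβ A hA, hv]
    ext c m
    simp [coeff_vecComponent]
  have hwb : w b = C (constantCoeff (v b)) := by
    ext m
    rw [hw, coeff_vecComponent, coeff_C]
    have e : m.degree + dβ b = dβ b ↔ 0 = m := by
      rw [add_eq_right, Finsupp.degree_eq_zero_iff, eq_comm]
    by_cases h : 0 = m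
    · rw [if_pos h, if_pos (e.2 h), ← h]
      rfl
    · rw [if_neg h, if_neg (fun h' => h (e.1 h'))]
  rw [Matrix.range_mulVecLin, Matrix.range_mulVecLin]
  apply le_antisymm
  · apply Submodule.span_mono
    rintro _ ⟨p, rfl⟩
    exact ⟨p.1, rfl⟩
  · rw [Submodule.span_le]
    have hne : ∀ b', b' ≠ b → A.col b' ∈ Submodule.span (MvPolynomial σ K)
        (Set.range (A.submatrix id (Subtype.val : {b' // b' ≠ b} → β)).col) :=
      fun b' h => Submodule.subset_span ⟨⟨b', h⟩, rfl⟩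
    rintro _ ⟨b', rfl⟩
    by_cases h : b' = b
    · subst h
      have e : ∑ k, w k • A.col k = 0 := by
        rw [← hAw]
        ext1 c
        simp [Matrix.mulVec, dotProduct, mul_comm]
      rw [← Finset.add_sum_erase _ _ (Finset.mem_univ b'), hwb] at e
      have e' : A.col b' = (C (constantCoeff (v b'))⁻¹ : MvPolynomial σ K) •
          -(∑ k ∈ Finset.univ.erase b', w k • A.col k) := by
        rw [← eq_neg_of_add_eq_zero_left e, smul_smul, ← C_mul, inv_mul_cancel₀ hb, C_1, one_smul]
      rw [e']
      exact Submodule.smul_mem _ _ (Submodule.neg_mem _ (Submodule.sum_mem _ fun k hk =>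
        Submodule.smul_mem _ _ (hne k (Finset.ne_of_mem_erase hk))))
    · exact hne b' h

/-- A homogeneous generating family of least cardinality works: a relation with a nonzero constant
term would make one generator redundant. -/
lemma GradedSub.exists_minimal_cover [Finite σ] (N : GradedSub σ K) :
    ∃ (β : Type) (_ : Fintype β) (dβ : β → ℕ) (A : Matrix N.gen β (MvPolynomial σ K)),
      IsHomogMat N.deg dβ A ∧ LinearMap.range A.mulVecLin = N.sub ∧
      ∀ v, A.mulVec v = 0 → ∀ b, constantCoeff (v b) = 0 := by
  classical
  have hex : ∃ n, ∃ (β : Type) (_ : Fintype β) (dβ : β → ℕ)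
      (A : Matrix N.gen β (MvPolynomial σ K)),
      IsHomogMat N.deg dβ A ∧ LinearMap.range A.mulVecLin = N.sub ∧ Fintype.card β = n := by
    obtain ⟨β, hβ, dβ, A, h1, h2⟩ := N.exists_cover
    exact ⟨_, β, hβ, dβ, A, h1, h2, rfl⟩
  obtain ⟨β, hβ, dβ, A, h1, h2, h3⟩ := Nat.find_spec hex
  refine ⟨β, hβ, dβ, A, h1, h2, fun v hv b => ?_⟩
  by_contra hb
  refine Nat.find_min hex (m := Fintype.card {b' // b' ≠ b}) ?_
    ⟨{b' // b' ≠ b}, inferInstance, fun b' => dβ b', A.submatrix id Subtype.val,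
      fun b' => h1 b', ?_, rfl⟩
  · rw [← h3]
    exact Fintype.card_subtype_lt (x := b) (by simp)
  · rw [range_submatrix_of_constantCoeff_ne_zero h1 hv hb, h2]

/-- Every homogeneous ideal of a polynomial ring in finitely many variables over a field has a
minimal graded free resolution. -/
theorem exists_isMinimal [Finite σ] (I : Ideal (MvPolynomial σ K))
    (hI : I.IsHomogeneous (homogeneousSubmodule σ K)) :
    ∃ F : GradedFreeResolution I, F.IsMinimal := by
  obtain ⟨N, hN0, hN⟩ := exists_dependent_sequence (X := fun _ => GradedSub σ K)
    (fun _ N M => ∃ A : Matrix N.gen M.gen (MvPolynomial σ K), IsHomogMat N.deg M.deg A ∧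
      LinearMap.range A.mulVecLin = N.sub ∧ LinearMap.ker A.mulVecLin = M.sub ∧
      ∀ v ∈ M.sub, ∀ b, constantCoeff (v b) = 0) (GradedSub.ofIdeal I hI) (by
      intro _ N
      obtain ⟨β, _, dβ, A, h1, h2, h3⟩ := N.exists_minimal_cover
      refine ⟨⟨β, inferInstance, dβ, LinearMap.ker A.mulVecLin, ?_⟩, A, h1, h2, rfl, h3⟩
      intro v hv n
      rw [LinearMap.mem_ker, Matrix.mulVecLin_apply] at hv ⊢
      rw [← vecComponent_mulVec _ _ _ h1, hv]
      ext c m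
      simp [coeff_vecComponent])
  choose A hA hr hk hm using hN
  -- `N 0` equals `GradedSub.ofIdeal I hI` only propositionally. Generalizing `A 0` before rewriting
  -- turns it into a matrix with one row.
  obtain ⟨B, hB, hBr, hBk⟩ : ∃ B : Matrix Unit (N 1).gen (MvPolynomial σ K),
      IsHomogMat (fun _ => 0) (N 1).deg B ∧
      (∀ x, x ∈ LinearMap.range B.mulVecLin ↔ x () ∈ I) ∧
      LinearMap.ker B.mulVecLin = (N 1).sub := by
    have h1 := hA 0
    have h2 := hr 0
    have h3 := hk 0
    generalize A 0 = A₀ at h1 h2 h3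
    revert A₀
    rw [hN0]
    intro A₀ h1 h2 h3
    exact ⟨A₀, h1, fun x => (SetLike.ext_iff.1 h2 x).trans Iff.rfl, h3⟩
  have key : ∀ v, Fintype.linearCombination (MvPolynomial σ K) (fun b => B () b) v =
      B.mulVecLin v () := by
    intro v
    rw [Fintype.linearCombination_apply, Matrix.mulVecLin_apply]
    exact Finset.sum_congr rfl fun b _ => mul_comm _ _
  refine ⟨{
    gen := fun i => (N (i + 1)).gen
    fintypeGen := fun i => (N (i + 1)).fintypeGen
    deg := fun i => (N (i + 1)).deg
    aug := fun b => B () b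
    d := fun i => A (i + 1)
    aug_homogeneous := ?_
    d_homogeneous := fun i => hA (i + 1)
    range_aug := ?_
    exact_zero := ?_
    exact_succ := fun i => (hr (i + 1 + 1)).trans (hk (i + 1)).symm }, ?_⟩
  · intro b m hm
    have h := hB b () m (mem_support_iff.2 hm)
    exact (congrArg (fun f => f m) Finsupp.degree_eq_weight_one).symm.trans h
  · ext x
    rw [← hBr (fun _ => x)]
    exact ⟨fun ⟨v, hv⟩ => ⟨v, funext fun _ => (key v).symm.trans hv⟩,
      fun ⟨v, hv⟩ => ⟨v, (key v).trans (congrFun hv ())⟩⟩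
  · refine (hr 1).trans (hBk.symm.trans ?_)
    ext v
    rw [LinearMap.mem_ker, LinearMap.mem_ker, key v]
    exact ⟨fun h => congrFun h (), fun h => funext fun _ => h⟩
  -- The columns of the differential lie in the syzygy module of a minimal cover, whose elements
  -- vanish modulo the variables.
  · intro i c b
    refine hm i (fun c => A (i + 1) c b) ?_ c
    rw [← hr (i + 1), Matrix.range_mulVecLin]
    exact Submodule.subset_span ⟨b, rfl⟩

end GradedFreeResolution

/-! ### Resolutions with all homological degrees collected in one module. -/

/-- A minimal graded free resolution of `I`, with the free modules of all homological degrees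
collected in one free module with basis `gen`. -/
structure TotalResolution {σ K : Type*} [Field K] (I : Ideal (MvPolynomial σ K)) where
  gen : Type
  hdeg : gen → ℕ
  ddeg : gen → ℕ
  finite_hdeg : ∀ i, Finite {g // hdeg g = i}
  d : (gen →₀ MvPolynomial σ K) →ₗ[MvPolynomial σ K] (gen →₀ MvPolynomial σ K)
  aug : (gen →₀ MvPolynomial σ K) →ₗ[MvPolynomial σ K] MvPolynomial σ K
  hdeg_of_ne : ∀ g c, d (Finsupp.single g 1) c ≠ 0 → hdeg c + 1 = hdeg g
  d_homogeneous : ∀ g, IsHomogVec ddeg (ddeg g) (d (Finsupp.single g 1))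
  d_minimal : ∀ g c, constantCoeff (d (Finsupp.single g 1) c) = 0
  aug_eq_zero : ∀ g, hdeg g ≠ 0 → aug (Finsupp.single g 1) = 0
  aug_homogeneous : ∀ g, (aug (Finsupp.single g 1)).IsHomogeneous (ddeg g)
  range_aug : LinearMap.range aug = I
  aug_d : ∀ z, aug (d z) = 0
  d_d : ∀ z, d (d z) = 0
  exact : ∀ z, d z = 0 → aug z = 0 → ∃ y, d y = z

namespace TotalResolution

variable {σ K : Type*} [Field K] {I : Ideal (MvPolynomial σ K)} (T : TotalResolution I)

lemma d_single (g : T.gen) (f : MvPolynomial σ K) :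
    T.d (Finsupp.single g f) = f • T.d (Finsupp.single g 1) := by
  rw [← map_smul, Finsupp.smul_single, smul_eq_mul, mul_one]

lemma aug_single (g : T.gen) (f : MvPolynomial σ K) :
    T.aug (Finsupp.single g f) = f * T.aug (Finsupp.single g 1) := by
  rw [← smul_eq_mul, ← map_smul, Finsupp.smul_single, smul_eq_mul, mul_one]

instance fintypeHdeg (i : ℕ) : Fintype {g // T.hdeg g = i} :=
  have := T.finite_hdeg i
  Fintype.ofFinite _

/-- The matrix of the differential in one homological degree. -/
def mat (i : ℕ) : Matrix {g // T.hdeg g = i} {g // T.hdeg g = i + 1} (MvPolynomial σ K) :=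
  Matrix.of fun c b => T.d (Finsupp.single b.1 1) c.1

/-- The inclusion of one homological degree. -/
def incl (i : ℕ) (v : {g // T.hdeg g = i} → MvPolynomial σ K) : T.gen →₀ MvPolynomial σ K :=
  ∑ b, Finsupp.single b.1 (v b)

lemma incl_apply (i : ℕ) (v : {g // T.hdeg g = i} → MvPolynomial σ K) (c : {g // T.hdeg g = i}) :
    T.incl i v c.1 = v c := by
  classical
  simp [incl, Finsupp.finsetSum_apply, Finsupp.single_apply, ← Subtype.ext_iff]

lemma incl_apply_of_ne (i : ℕ) (v : {g // T.hdeg g = i} → MvPolynomial σ K) {c : T.gen}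
    (hc : T.hdeg c ≠ i) : T.incl i v c = 0 := by
  classical
  rw [incl, Finsupp.finsetSum_apply]
  refine Finset.sum_eq_zero fun b _ => Finsupp.single_eq_of_ne ?_
  rintro rfl
  exact hc b.2

lemma d_incl_zero (v : {g // T.hdeg g = 0} → MvPolynomial σ K) : T.d (T.incl 0 v) = 0 := by
  rw [incl, map_sum]
  refine Finset.sum_eq_zero fun b _ => ?_
  rw [d_single]
  ext1 c
  by_contra h
  have := T.hdeg_of_ne b.1 c fun h' => h (by simp [h'])
  have := b.2
  omega

lemma d_incl_succ (i : ℕ) (v : {g // T.hdeg g = i + 1} → MvPolynomial σ K) :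
    T.d (T.incl (i + 1) v) = T.incl i ((T.mat i).mulVec v) := by
  ext1 c
  have e : T.d (T.incl (i + 1) v) c = ∑ b, v b * T.d (Finsupp.single b.1 1) c := by
    rw [incl, map_sum, Finsupp.finsetSum_apply]
    refine Finset.sum_congr rfl fun b _ => ?_
    rw [d_single]
    rfl
  rw [e]
  by_cases hc : T.hdeg c = i
  · have := T.incl_apply i ((T.mat i).mulVec v) ⟨c, hc⟩
    rw [this]
    exact Finset.sum_congr rfl fun b _ => mul_comm _ _
  · rw [incl_apply_of_ne _ _ _ hc]
    refine Finset.sum_eq_zero fun b _ => ?_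
    by_contra h
    have := T.hdeg_of_ne b.1 c (right_ne_zero_of_mul h)
    have := b.2
    omega

/-- A preimage under the total differential may be spread over many degrees. This formula allows it
to be truncated to degree `i + 1`, which gives exactness in each single degree. -/
lemma d_apply (i : ℕ) (y : T.gen →₀ MvPolynomial σ K) (c : {g // T.hdeg g = i}) :
    T.d y c.1 = (T.mat i).mulVec (fun b => y b.1) c := by
  classical
  induction y using Finsupp.induction_linear with
  | zero => simp [Matrix.mulVec, dotProduct]
  | add y z hy hz =>
    rw [map_add, Finsupp.add_apply, hy, hz]
    exact congrFun (Matrix.mulVec_add (T.mat i) _ _).symm c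
  | single g f =>
    rw [d_single, Finsupp.smul_apply, smul_eq_mul]
    by_cases hg : T.hdeg g = i + 1
    · rw [Matrix.mulVec, dotProduct, Finset.sum_eq_single ⟨g, hg⟩]
      · rw [Finsupp.single_eq_same, mul_comm]
        rfl
      · intro b _ hb
        rw [Finsupp.single_eq_of_ne, mul_zero]
        rintro rfl
        exact hb rfl
      · simp
    · rw [Matrix.mulVec, dotProduct, Finset.sum_eq_zero]
      · by_contra h
        have := T.hdeg_of_ne g c (right_ne_zero_of_mul h)
        have := c.2
        omega
      · intro b _
        rw [Finsupp.single_eq_of_ne, mul_zero]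
        rintro rfl
        exact hg b.2

lemma aug_apply (y : T.gen →₀ MvPolynomial σ K) : T.aug y =
    Fintype.linearCombination (MvPolynomial σ K)
      (fun b : {g // T.hdeg g = 0} => T.aug (Finsupp.single b.1 1)) (fun b => y b.1) := by
  classical
  induction y using Finsupp.induction_linear with
  | zero => simp [Fintype.linearCombination_apply]
  | add y z hy hz =>
    rw [map_add, hy, hz, ← map_add]
    rfl
  | single g f =>
    rw [aug_single, Fintype.linearCombination_apply]
    by_cases hg : T.hdeg g = 0
    · rw [Finset.sum_eq_single ⟨g, hg⟩]
      · rw [Finsupp.single_eq_same, smul_eq_mul]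
      · intro b _ hb
        rw [Finsupp.single_eq_of_ne, zero_smul]
        rintro rfl
        exact hb rfl
      · simp
    · rw [T.aug_eq_zero g hg, mul_zero, Finset.sum_eq_zero]
      intro b _
      rw [Finsupp.single_eq_of_ne, zero_smul]
      rintro rfl
      exact hg b.2

lemma aug_incl_zero (v : {g // T.hdeg g = 0} → MvPolynomial σ K) : T.aug (T.incl 0 v) =
    Fintype.linearCombination (MvPolynomial σ K)
      (fun b : {g // T.hdeg g = 0} => T.aug (Finsupp.single b.1 1)) v := by
  rw [aug_apply]
  exact congrArg _ (funext fun b => T.incl_apply 0 v b)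

lemma aug_incl_succ (i : ℕ) (v : {g // T.hdeg g = i + 1} → MvPolynomial σ K) :
    T.aug (T.incl (i + 1) v) = 0 := by
  rw [aug_apply, Fintype.linearCombination_apply]
  refine Finset.sum_eq_zero fun b _ => ?_
  rw [incl_apply_of_ne, zero_smul]
  have := b.2
  omega

lemma incl_zero (i : ℕ) : T.incl i 0 = 0 := by
  simp [incl]

lemma incl_injective (i : ℕ) : Function.Injective (T.incl i) := by
  intro v w h
  ext1 c
  rw [← T.incl_apply i v c, h, incl_apply]

/-- Separate the homological degrees. -/
def toGradedFreeResolution : GradedFreeResolution I where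
  gen := fun i => {g // T.hdeg g = i}
  fintypeGen := T.fintypeHdeg
  deg := fun _ g => T.ddeg g.1
  aug := fun b => T.aug (Finsupp.single b.1 1)
  d := T.mat
  aug_homogeneous := fun b => T.aug_homogeneous b.1
  d_homogeneous := fun _ b c => T.d_homogeneous b.1 c.1
  range_aug := by
    conv_rhs => rw [← T.range_aug]
    ext x
    constructor
    · rintro ⟨v, rfl⟩
      exact ⟨_, T.aug_incl_zero v⟩
    · rintro ⟨y, rfl⟩
      exact ⟨_, (T.aug_apply y).symm⟩
  exact_zero := by
    ext v
    rw [LinearMap.mem_ker, ← aug_incl_zero]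
    constructor
    · rintro ⟨w, rfl⟩
      rw [Matrix.mulVecLin_apply, ← d_incl_succ, aug_d]
    · intro h
      obtain ⟨y, hy⟩ := T.exact _ (T.d_incl_zero v) h
      refine ⟨fun b => y b.1, ?_⟩
      ext1 c
      rw [Matrix.mulVecLin_apply, ← d_apply, hy, incl_apply]
  exact_succ := by
    intro i
    ext v
    rw [LinearMap.mem_ker, Matrix.mulVecLin_apply]
    constructor
    · rintro ⟨w, rfl⟩
      apply T.incl_injective
      rw [Matrix.mulVecLin_apply, ← d_incl_succ, ← d_incl_succ, d_d, incl_zero]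
    · intro h
      obtain ⟨y, hy⟩ := T.exact (T.incl (i + 1) v) (by rw [d_incl_succ, h, incl_zero])
        (T.aug_incl_succ i v)
      refine ⟨fun b => y b.1, ?_⟩
      ext1 c
      rw [Matrix.mulVecLin_apply, ← d_apply, hy, incl_apply]

lemma isMinimal_toGradedFreeResolution : T.toGradedFreeResolution.IsMinimal :=
  fun _ c b => T.d_minimal b.1 c.1

/-- The bidegree of a generator. -/
def bideg (g : T.gen) : Fin 2 →₀ ℕ :=
  Finsupp.single 0 (T.hdeg g) + Finsupp.single 1 (T.ddeg g)

lemma bideg_eq_iff (g : T.gen) (m : Fin 2 →₀ ℕ) :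
    T.bideg g = m ↔ T.hdeg g = m 0 ∧ T.ddeg g = m 1 := by
  constructor
  · rintro rfl
    simp [bideg]
  · rintro ⟨h0, h1⟩
    ext i
    fin_cases i <;> simp [bideg, h0, h1]

lemma finite_bideg (m : Fin 2 →₀ ℕ) : Finite {g // T.bideg g = m} := by
  have := T.finite_hdeg (m 0)
  exact Finite.of_injective (β := {g // T.hdeg g = m 0})
    (fun g => ⟨g.1, ((T.bideg_eq_iff _ _).1 g.2).1⟩)
    (fun a b h => Subtype.ext (congrArg (fun x => x.1) h))

/-- The Betti series counts the generators of a minimal resolution by bidegree. -/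
lemma coeff_bettiSeries [Finite σ] (hI : I.IsHomogeneous (homogeneousSubmodule σ K))
    (m : Fin 2 →₀ ℕ) :
    MvPowerSeries.coeff m (bettiSeries I hI) = Nat.card {g // T.bideg g = m} := by
  change ((gradedBetti I hI (m 0) (m 1) : ℕ) : ℤ) = _
  rw [gradedBetti, GradedFreeResolution.finrank_tor_eq_card T.isMinimal_toGradedFreeResolution]
  congr 1
  refine Nat.card_congr ((Equiv.subtypeSubtypeEquivSubtypeInter _
    (fun g => T.ddeg g = m 1)).trans (Equiv.subtypeEquivRight fun g => ?_))
  exact (T.bideg_eq_iff g m).symm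

end TotalResolution

namespace GradedFreeResolution

variable {σ K : Type*} [Field K] {I : Ideal (MvPolynomial σ K)} (F : GradedFreeResolution I)

/-- The inclusion of one homological degree in the sum over all homological degrees. -/
def incl (i : ℕ) (v : F.gen i → MvPolynomial σ K) : (Σ i, F.gen i) →₀ MvPolynomial σ K :=
  ∑ b, Finsupp.single ⟨i, b⟩ (v b)

/-- The total differential on the basis. -/
def totalCol : (Σ i, F.gen i) → ((Σ i, F.gen i) →₀ MvPolynomial σ K)
  | ⟨0, _⟩ => 0
  | ⟨i + 1, b⟩ => F.incl i fun c => F.d i c b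

/-- The total differential. -/
def totalD : ((Σ i, F.gen i) →₀ MvPolynomial σ K) →ₗ[MvPolynomial σ K]
    ((Σ i, F.gen i) →₀ MvPolynomial σ K) :=
  Finsupp.linearCombination _ F.totalCol

/-- The augmentation on the basis. -/
def totalAugCol : (Σ i, F.gen i) → MvPolynomial σ K
  | ⟨0, b⟩ => F.aug b
  | ⟨_ + 1, _⟩ => 0

/-- The augmentation on the sum over all homological degrees. -/
def totalAug : ((Σ i, F.gen i) →₀ MvPolynomial σ K) →ₗ[MvPolynomial σ K] MvPolynomial σ K :=
  Finsupp.linearCombination _ F.totalAugCol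

lemma incl_apply (i : ℕ) (v : F.gen i → MvPolynomial σ K) (c : F.gen i) :
    F.incl i v ⟨i, c⟩ = v c := by
  classical
  simp [incl, Finsupp.finsetSum_apply, Finsupp.single_apply]

lemma incl_apply_of_ne {i j : ℕ} (v : F.gen i → MvPolynomial σ K) (c : F.gen j) (h : j ≠ i) :
    F.incl i v ⟨j, c⟩ = 0 := by
  classical
  rw [incl, Finsupp.finsetSum_apply]
  refine Finset.sum_eq_zero fun b _ => Finsupp.single_eq_of_ne ?_
  intro e
  exact h (congrArg Sigma.fst e)

lemma incl_zero (i : ℕ) : F.incl i 0 = 0 := by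
  simp [incl]

lemma totalD_incl_zero (v : F.gen 0 → MvPolynomial σ K) : F.totalD (F.incl 0 v) = 0 := by
  simp [incl, totalD, totalCol]

lemma totalD_incl_succ (i : ℕ) (v : F.gen (i + 1) → MvPolynomial σ K) :
    F.totalD (F.incl (i + 1) v) = F.incl i ((F.d i).mulVec v) := by
  simp only [incl, totalD, map_sum, Finsupp.linearCombination_single, totalCol, Finset.smul_sum,
    Finsupp.smul_single, smul_eq_mul]
  rw [Finset.sum_comm]
  refine Finset.sum_congr rfl fun c _ => ?_
  rw [← Finsupp.single_finsetSum]
  exact congrArg _ (Finset.sum_congr rfl fun b _ => mul_comm _ _)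

lemma totalAug_incl_zero (v : F.gen 0 → MvPolynomial σ K) :
    F.totalAug (F.incl 0 v) = Fintype.linearCombination (MvPolynomial σ K) F.aug v := by
  simp [incl, totalAug, totalAugCol, Fintype.linearCombination_apply]

lemma totalAug_incl_succ (i : ℕ) (v : F.gen (i + 1) → MvPolynomial σ K) :
    F.totalAug (F.incl (i + 1) v) = 0 := by
  simp [incl, totalAug, totalAugCol]

lemma exists_eq_sum_incl (z : (Σ i, F.gen i) →₀ MvPolynomial σ K) :
    ∃ n, z = ∑ i ∈ Finset.range n, F.incl i fun b => z ⟨i, b⟩ := by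
  classical
  refine ⟨z.support.sup (fun g => g.1 + 1), ?_⟩
  ext1 ⟨j, c⟩
  rw [Finsupp.finsetSum_apply]
  by_cases hc : z ⟨j, c⟩ = 0
  · rw [hc, Finset.sum_eq_zero]
    intro i _
    by_cases h : j = i
    · subst h
      rw [incl_apply, hc]
    · exact F.incl_apply_of_ne _ _ h
  · rw [Finset.sum_eq_single j, incl_apply]
    · intro i _ h
      exact F.incl_apply_of_ne _ _ h.symm
    · intro h
      refine absurd (Finset.mem_range.2 ?_) h
      exact Nat.lt_of_succ_le
        (Finset.le_sup (f := fun g : Σ i, F.gen i => g.1 + 1) (Finsupp.mem_support_iff.2 hc))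

/-- Every element is a finite sum of pieces of a single degree, so identities for the total maps
reduce to the matrix identities of `F`. -/
lemma linearMap_ext_incl {M : Type*} [AddCommGroup M] [Module (MvPolynomial σ K) M]
    {f g : ((Σ i, F.gen i) →₀ MvPolynomial σ K) →ₗ[MvPolynomial σ K] M}
    (h : ∀ i v, f (F.incl i v) = g (F.incl i v)) : f = g := by
  refine LinearMap.ext fun z => ?_
  obtain ⟨n, hn⟩ := F.exists_eq_sum_incl z
  rw [hn, map_sum, map_sum]
  exact Finset.sum_congr rfl fun i _ => h i _

lemma totalD_totalD : F.totalD ∘ₗ F.totalD = 0 := by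
  refine F.linearMap_ext_incl fun i v => ?_
  match i with
  | 0 => simp [totalD_incl_zero]
  | 1 => simp [totalD_incl_succ, totalD_incl_zero]
  | i + 2 => simp [totalD_incl_succ, d_mul_d, incl_zero]

lemma totalAug_totalD : F.totalAug ∘ₗ F.totalD = 0 := by
  refine F.linearMap_ext_incl fun i v => ?_
  match i with
  | 0 => simp [totalD_incl_zero]
  | 1 =>
    have h : (F.d 0).mulVecLin v ∈ LinearMap.range (F.d 0).mulVecLin := ⟨v, rfl⟩
    rw [F.exact_zero, LinearMap.mem_ker, Matrix.mulVecLin_apply] at h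
    rw [LinearMap.comp_apply, totalD_incl_succ, totalAug_incl_zero, h, LinearMap.zero_apply]
  | i + 2 => simp [totalD_incl_succ, totalAug_incl_succ]

lemma totalD_apply (y : (Σ i, F.gen i) →₀ MvPolynomial σ K) (i : ℕ) (c : F.gen i) :
    F.totalD y ⟨i, c⟩ = (F.d i).mulVec (fun b => y ⟨i + 1, b⟩) c := by
  let f : ((Σ i, F.gen i) →₀ MvPolynomial σ K) →ₗ[MvPolynomial σ K] MvPolynomial σ K :=
    LinearMap.proj c ∘ₗ (F.d i).mulVecLin ∘ₗ
      LinearMap.pi fun b => Finsupp.lapply (⟨i + 1, b⟩ : Σ i, F.gen i)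
  have h : Finsupp.lapply (⟨i, c⟩ : Σ i, F.gen i) ∘ₗ F.totalD = f := by
    refine F.linearMap_ext_incl fun j v => ?_
    change F.totalD (F.incl j v) ⟨i, c⟩ = (F.d i).mulVec (fun b => F.incl j v ⟨i + 1, b⟩) c
    by_cases hj : j = i + 1
    · subst hj
      rw [totalD_incl_succ, incl_apply]
      simp_rw [incl_apply]
    · have e : (fun b => F.incl j v ⟨i + 1, b⟩) = 0 :=
        funext fun b => F.incl_apply_of_ne v b (Ne.symm hj)
      rw [e, Matrix.mulVec_zero]
      cases j with
      | zero => rw [totalD_incl_zero]; rfl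
      | succ j =>
        rw [totalD_incl_succ]
        exact F.incl_apply_of_ne _ _ (by omega)
  exact LinearMap.congr_fun h y

lemma totalAug_apply (y : (Σ i, F.gen i) →₀ MvPolynomial σ K) :
    F.totalAug y = Fintype.linearCombination (MvPolynomial σ K) F.aug (fun b => y ⟨0, b⟩) := by
  let f : ((Σ i, F.gen i) →₀ MvPolynomial σ K) →ₗ[MvPolynomial σ K] MvPolynomial σ K :=
    Fintype.linearCombination (MvPolynomial σ K) F.aug ∘ₗ
      LinearMap.pi fun b => Finsupp.lapply (⟨0, b⟩ : Σ i, F.gen i)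
  have h : F.totalAug = f := by
    refine F.linearMap_ext_incl fun j v => ?_
    change _ = Fintype.linearCombination (MvPolynomial σ K) F.aug (fun b => F.incl j v ⟨0, b⟩)
    cases j with
    | zero => simp_rw [totalAug_incl_zero, incl_apply]
    | succ j =>
      have e : (fun b => F.incl (j + 1) v ⟨0, b⟩) = 0 :=
        funext fun b => F.incl_apply_of_ne v b (by omega)
      rw [totalAug_incl_succ, e, map_zero]
  exact LinearMap.congr_fun h y

/-- Preimages are chosen in each degree separately; only finitely many degrees of `z` matter. In
degree 0 being a cycle is no condition, and the vanishing of the augmentation takes its place. -/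
lemma totalD_exact (z : (Σ i, F.gen i) →₀ MvPolynomial σ K) (hd : F.totalD z = 0)
    (ha : F.totalAug z = 0) : ∃ y, F.totalD y = z := by
  have hw : ∀ i, ∃ w, (F.d i).mulVec w = fun b => z ⟨i, b⟩ := by
    intro i
    cases i with
    | zero =>
      have : (fun b => z ⟨0, b⟩) ∈ LinearMap.range (F.d 0).mulVecLin := by
        rw [F.exact_zero, LinearMap.mem_ker, ← totalAug_apply, ha]
      exact this
    | succ i =>
      have : (fun b => z ⟨i + 1, b⟩) ∈ LinearMap.range (F.d (i + 1)).mulVecLin := by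
        rw [F.exact_succ, LinearMap.mem_ker, Matrix.mulVecLin_apply]
        ext1 c
        rw [← totalD_apply, hd]
        rfl
      exact this
  choose w hw using hw
  obtain ⟨n, hn⟩ := F.exists_eq_sum_incl z
  refine ⟨∑ i ∈ Finset.range n, F.incl (i + 1) (w i), ?_⟩
  rw [map_sum]
  conv_rhs => rw [hn]
  exact Finset.sum_congr rfl fun i _ => by rw [totalD_incl_succ, hw]

/-- Collect the homological degrees. -/
def toTotalResolution (hF : F.IsMinimal) : TotalResolution I where
  gen := Σ i, F.gen i
  hdeg := fun g => g.1
  ddeg := fun g => F.deg g.1 g.2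
  finite_hdeg := fun i => Finite.of_surjective (α := F.gen i) (fun b => ⟨⟨i, b⟩, rfl⟩) (by
    rintro ⟨⟨_, b⟩, rfl⟩
    exact ⟨b, rfl⟩)
  d := F.totalD
  aug := F.totalAug
  hdeg_of_ne := by
    rintro ⟨i, b⟩ ⟨j, c⟩ h
    rw [totalD, Finsupp.linearCombination_single, one_smul] at h
    cases i with
    | zero => exact absurd rfl h
    | succ i =>
      by_contra hne
      refine h (F.incl_apply_of_ne _ _ ?_)
      rintro rfl
      exact hne rfl
  d_homogeneous := by
    rintro ⟨i, b⟩ ⟨j, c⟩ m hm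
    rw [totalD, Finsupp.linearCombination_single, one_smul] at hm
    cases i with
    | zero => exact absurd hm (by simp [totalCol])
    | succ i =>
      rw [totalCol] at hm
      by_cases h : j = i
      · subst h
        rw [incl_apply] at hm
        exact F.d_homogeneous j b c m hm
      · rw [F.incl_apply_of_ne _ _ h] at hm
        simp at hm
  d_minimal := by
    rintro ⟨i, b⟩ ⟨j, c⟩
    rw [totalD, Finsupp.linearCombination_single, one_smul]
    cases i with
    | zero => simp [totalCol]
    | succ i =>
      rw [totalCol]
      by_cases h : j = i
      · subst h
        rw [incl_apply]
        exact hF j c b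
      · rw [F.incl_apply_of_ne _ _ h, map_zero]
  aug_eq_zero := by
    rintro ⟨i, b⟩ h
    cases i with
    | zero => exact absurd rfl h
    | succ i => simp [totalAug, totalAugCol]
  aug_homogeneous := by
    rintro ⟨i, b⟩
    rw [totalAug, Finsupp.linearCombination_single, one_smul]
    cases i with
    | zero => exact F.aug_homogeneous b
    | succ i => exact isHomogeneous_zero _ _ _
  range_aug := by
    conv_rhs => rw [← F.range_aug]
    ext x
    constructor
    · rintro ⟨y, rfl⟩
      exact ⟨_, (F.totalAug_apply y).symm⟩
    · rintro ⟨v, rfl⟩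
      exact ⟨_, F.totalAug_incl_zero v⟩
  aug_d := LinearMap.congr_fun F.totalAug_totalD
  d_d := LinearMap.congr_fun F.totalD_totalD
  exact := F.totalD_exact

end GradedFreeResolution

/-! ### Tensor products of exact complexes of vector spaces. -/

/-- In a ring, the odd part of a contracting homotopy `h` of an odd differential `d` with respect to
the projection `p` on the even part is again a contracting homotopy. -/
lemma odd_part_homotopy {R : Type*} [Ring R] {p d h e : R} (hpd : p * d + d * p = d)
    (hpp : p * p = p) (hpe : p * e = e) (hep : e * p = e) (hd : d * h + h * d = 1 - e) :
    d * (p * h * (1 - p) + (1 - p) * h * p) + (p * h * (1 - p) + (1 - p) * h * p) * d = 1 - e := by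
  -- This and the next identity say that `d` exchanges the even and the odd part.
  have h1 : d * p = (1 - p) * d := by rw [sub_mul, one_mul]; exact eq_sub_of_add_eq' hpd
  have h2 : d * (1 - p) = p * d := by rw [mul_sub, mul_one]; exact (eq_sub_of_add_eq hpd).symm
  calc _ = (d * p) * h * (1 - p) + (d * (1 - p)) * h * p +
        (p * h * ((1 - p) * d) + (1 - p) * h * (p * d)) := by noncomm_ring
    _ = ((1 - p) * d) * h * (1 - p) + (p * d) * h * p +
        (p * h * (d * p) + (1 - p) * h * (d * (1 - p))) := by rw [h1, h2]
    _ = (1 - p) * (d * h + h * d) * (1 - p) + p * (d * h + h * d) * p := by noncomm_ring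
    _ = (1 - p) * (1 - p) - (e - p * e) * (1 - p) + p * p - p * e * p := by
      rw [hd]; noncomm_ring
    _ = 1 - e := by
      rw [hpe, hep, hpp, sub_self, zero_mul]
      have : (1 - p) * (1 - p) = 1 - p := by
        rw [mul_sub, mul_one, sub_mul, one_mul, hpp, sub_self, sub_zero]
      rw [this]
      abel

/-- A projection onto the range followed by a section over the range is a generalized inverse. This
is where linear algebra over a field is needed for the splitting. -/
lemma LinearMap.exists_mul_self_mul_eq {K V W : Type*} [Field K] [AddCommGroup V] [Module K V]
    [AddCommGroup W] [Module K W] (f : V →ₗ[K] W) : ∃ g : W →ₗ[K] V, ∀ v, f (g (f v)) = f v := by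
  obtain ⟨r, hr⟩ := f.rangeRestrict.exists_rightInverse_of_surjective f.range_rangeRestrict
  obtain ⟨q, hq⟩ := (LinearMap.range f).subtype.exists_leftInverse_of_injective
    (Submodule.ker_subtype _)
  refine ⟨r ∘ₗ q, fun v => ?_⟩
  have h1 : q (f v) = f.rangeRestrict v := LinearMap.congr_fun hq (f.rangeRestrict v)
  have h2 := congrArg Subtype.val (LinearMap.congr_fun hr (f.rangeRestrict v))
  rw [LinearMap.comp_apply, h1]
  exact h2

/-- An exact complex of vector spaces, with the terms of all degrees collected in one vector space
`V`. The grading is remembered through the projections on the even part and on the part of degree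
`0`. -/
structure AugmentedComplex (K V W : Type*) [Field K] [AddCommGroup V] [Module K V]
    [AddCommGroup W] [Module K W] where
  d : V →ₗ[K] V
  aug : V →ₗ[K] W
  even : V →ₗ[K] V
  zero : V →ₗ[K] V
  even_d : ∀ y, even (d y) + d (even y) = d y
  even_even : ∀ y, even (even y) = even y
  even_zero : ∀ y, even (zero y) = zero y
  aug_even : ∀ y, aug (even y) = aug y
  aug_zero : ∀ y, aug (zero y) = aug y
  d_zero : ∀ y, d (zero y) = 0
  aug_d : ∀ y, aug (d y) = 0
  d_d : ∀ y, d (d y) = 0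
  exact : ∀ z, d z = 0 → aug z = 0 → ∃ y, d y = z

namespace AugmentedComplex

variable {K V W : Type*} [Field K] [AddCommGroup V] [Module K V] [AddCommGroup W] [Module K W]
  (C : AugmentedComplex K V W)

/-- The operator that multiplies elements of degree `i` with `(-1) ^ i`. -/
def sign : Module.End K V := 2 * C.even - 1

/-- The differential as an element of the endomorphism ring. -/
abbrev dEnd : Module.End K V := C.d

/-- The projection on the even part as an element of the endomorphism ring. -/
abbrev evenEnd : Module.End K V := C.even

lemma sign_apply (y : V) : C.sign y = C.even y + C.even y - y := by
  rw [sign, two_mul]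
  rfl

lemma dEnd_mul_dEnd : C.dEnd * C.dEnd = 0 := LinearMap.ext C.d_d

lemma evenEnd_mul_dEnd : C.evenEnd * C.dEnd + C.dEnd * C.evenEnd = C.dEnd := LinearMap.ext C.even_d

lemma evenEnd_mul_evenEnd : C.evenEnd * C.evenEnd = C.evenEnd := LinearMap.ext C.even_even

lemma sign_mul_dEnd : C.sign * C.dEnd + C.dEnd * C.sign = 0 := by
  have h := C.evenEnd_mul_dEnd
  change (2 * C.evenEnd - 1) * C.dEnd + C.dEnd * (2 * C.evenEnd - 1) = 0
  generalize C.evenEnd = p at h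
  calc (2 * p - 1) * C.dEnd + C.dEnd * (2 * p - 1)
        = 2 * (p * C.dEnd + C.dEnd * p) - 2 * C.dEnd := by noncomm_ring
    _ = 0 := by rw [h, sub_self]

lemma aug_comp_sign : C.aug ∘ₗ C.sign = C.aug := by
  refine LinearMap.ext fun y => ?_
  rw [LinearMap.comp_apply, sign_apply, map_sub, map_add, aug_even, add_sub_cancel_right]

/-- An exact complex of vector spaces is split. -/
lemma exists_odd_homotopy : ∃ (h : Module.End K V) (t : W →ₗ[K] V),
    C.sign * h + h * C.sign = 0 ∧ C.sign ∘ₗ t = t ∧ C.d ∘ₗ t = 0 ∧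
    C.dEnd * h + h * C.dEnd = 1 - t ∘ₗ C.aug := by
  obtain ⟨t₀, ht₀⟩ := C.aug.exists_mul_self_mul_eq
  obtain ⟨k₀, hk₀⟩ := C.d.exists_mul_self_mul_eq
  -- Projecting to degree 0 does not affect the augmentation, and makes the values of `t` even and
  -- cycles.
  let t := C.zero ∘ₗ t₀
  have hdt : ∀ y, C.d (t y) = 0 := fun y => C.d_zero _
  have haug : ∀ y, C.aug (t (C.aug y)) = C.aug y := fun y => (C.aug_zero _).trans (ht₀ y)
  have hpt : ∀ y, C.even (t y) = t y := fun y => C.even_zero _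
  let e : Module.End K V := t ∘ₗ C.aug
  have hde : C.dEnd * e = 0 := LinearMap.ext fun y => hdt _
  have hed : e * C.dEnd = 0 := LinearMap.ext fun y => by
    change t (C.aug (C.d y)) = 0
    rw [C.aug_d, map_zero]
  -- The factor `1 - e` makes the augmentation vanish on the values of `k` and leaves `d * k`
  -- unchanged.
  let k : Module.End K V := (1 - e) * k₀
  have hdk : C.dEnd * k * C.dEnd = C.dEnd := by
    have h1 : C.dEnd * k = C.dEnd * k₀ := by
      change C.dEnd * ((1 - e) * k₀) = _
      rw [← mul_assoc, mul_sub, hde, mul_one, sub_zero]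
    rw [h1]
    exact LinearMap.ext hk₀
  have hak : ∀ y, C.aug (k y) = 0 := fun y => by
    change C.aug (k₀ y - t (C.aug (k₀ y))) = 0
    rw [map_sub, haug, sub_self]
  -- The values of `1 - e - k * d` are cycles with augmentation zero, hence boundaries, and `d * k`
  -- is the identity on boundaries.
  let h := k * (1 - e - k * C.dEnd)
  have hdh : C.dEnd * h = 1 - e - k * C.dEnd := by
    refine LinearMap.ext fun y => ?_
    obtain ⟨x, hx⟩ := C.exact ((1 - e - k * C.dEnd) y) (by
      change (C.dEnd * (1 - e - k * C.dEnd)) y = 0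
      rw [mul_sub, mul_sub, hde, mul_one, sub_zero, ← mul_assoc, hdk, sub_self,
        LinearMap.zero_apply]) (by
      change C.aug (y - t (C.aug y) - k (C.d y)) = 0
      rw [map_sub, map_sub, hak, sub_zero, haug, sub_self])
    change C.d (k ((1 - e - k * C.dEnd) y)) = _
    rw [← hx]
    exact LinearMap.congr_fun hdk x
  have hhd : h * C.dEnd = k * C.dEnd := by
    change k * (1 - e - k * C.dEnd) * C.dEnd = _
    rw [mul_assoc, sub_mul, sub_mul, hed, mul_assoc k, dEnd_mul_dEnd, mul_zero, one_mul, sub_zero,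
      sub_zero]
  have hh : C.dEnd * h + h * C.dEnd = 1 - e := by rw [hdh, hhd, sub_add_cancel]
  have hpe : C.evenEnd * e = e := LinearMap.ext fun y => hpt _
  have hep : e * C.evenEnd = e := LinearMap.ext fun y => congrArg t (C.aug_even y)
  -- `h` itself need not anticommute with the sign operator; its odd part does, and it is still a
  -- contracting homotopy.
  refine ⟨C.evenEnd * h * (1 - C.evenEnd) + (1 - C.evenEnd) * h * C.evenEnd, t, ?_, ?_,
    LinearMap.ext hdt,
    odd_part_homotopy C.evenEnd_mul_dEnd C.evenEnd_mul_evenEnd hpe hep hh⟩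
  · have hp := C.evenEnd_mul_evenEnd
    change (2 * C.evenEnd - 1) * _ + _ * (2 * C.evenEnd - 1) = 0
    generalize C.evenEnd = p at hp
    have h1 : (2 * p - 1) * p = p := by
      rw [sub_mul, mul_assoc, hp, one_mul, two_mul, add_sub_cancel_right]
    have h2 : p * (2 * p - 1) = p := by
      rw [mul_sub, two_mul, mul_add, hp, mul_one, add_sub_cancel_right]
    calc _ = ((2 * p - 1) * p) * h * (1 - p) + ((2 * p - 1) - (2 * p - 1) * p) * h * p +
          (p * h * ((2 * p - 1) - p * (2 * p - 1)) + (1 - p) * h * (p * (2 * p - 1))) := by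
            noncomm_ring
      _ = 0 := by rw [h1, h2]; noncomm_ring
  · refine LinearMap.ext fun y => ?_
    rw [LinearMap.comp_apply, sign_apply, hpt, add_sub_cancel_right]

variable {V' W' : Type*} [AddCommGroup V'] [Module K V'] [AddCommGroup W'] [Module K W']
  (C' : AugmentedComplex K V' W')

/-- The differential of the tensor product of two complexes. -/
def tensorD : Module.End K (V ⊗[K] V') :=
  TensorProduct.map C.dEnd 1 + TensorProduct.map C.sign C'.dEnd

lemma tensorD_tmul (u : V) (v : V') :
    C.tensorD C' (u ⊗ₜ v) = C.d u ⊗ₜ v + C.sign u ⊗ₜ C'.d v := rfl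

lemma tensorD_tensorD (z : V ⊗[K] V') : C.tensorD C' (C.tensorD C' z) = 0 := by
  have h : C.tensorD C' * C.tensorD C' = 0 := by
    rw [tensorD, add_mul, mul_add, mul_add, ← TensorProduct.map_mul, ← TensorProduct.map_mul,
      ← TensorProduct.map_mul, ← TensorProduct.map_mul, dEnd_mul_dEnd, dEnd_mul_dEnd, one_mul,
      mul_one, TensorProduct.map_zero_left, TensorProduct.map_zero_right, zero_add, add_zero,
      one_mul, ← TensorProduct.map_add_left, add_comm, sign_mul_dEnd, TensorProduct.map_zero_left]
  exact LinearMap.congr_fun h z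

lemma aug_tensorD (z : V ⊗[K] V') :
    TensorProduct.map C.aug C'.aug (C.tensorD C' z) = 0 := by
  induction z using TensorProduct.induction_on with
  | zero => simp
  | add x y hx hy => rw [map_add, map_add, hx, hy, add_zero]
  | tmul u v => simp [tensorD_tmul, C.aug_d, C'.aug_d]

/-- The tensor product of two exact complexes of vector spaces is exact. -/
lemma tensorD_exact (z : V ⊗[K] V') (hd : C.tensorD C' z = 0)
    (ha : TensorProduct.map C.aug C'.aug z = 0) : ∃ y, C.tensorD C' y = z := by
  obtain ⟨h, t, hs, hst, hdt, hh⟩ := C.exists_odd_homotopy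
  obtain ⟨h', t', -, -, -, hh'⟩ := C'.exists_odd_homotopy
  let e : Module.End K V := t ∘ₗ C.aug
  let e' : Module.End K V' := t' ∘ₗ C'.aug
  have hde : C.dEnd * e + e * C.dEnd = 0 := by
    refine LinearMap.ext fun y => ?_
    change C.d (t (C.aug y)) + t (C.aug (C.d y)) = 0
    rw [C.aug_d, map_zero, add_zero]
    exact LinearMap.congr_fun hdt _
  have hse : C.sign * e = e := LinearMap.ext fun y => LinearMap.congr_fun hst _
  have hes : e * C.sign = e :=
    LinearMap.ext fun y => congrArg t (LinearMap.congr_fun C.aug_comp_sign y)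
  -- `h ⊗ 1` contracts the first factor onto the image of `e`, and `e ⊗ h'` then contracts the
  -- second. No sign accompanies `h'` because `sign` fixes `e` on both sides. What remains is `e ⊗
  -- e'`, which factors through the tensor product of the augmentations.
  have key : C.tensorD C' * (TensorProduct.map h 1 + TensorProduct.map e h') +
      (TensorProduct.map h 1 + TensorProduct.map e h') * C.tensorD C' =
      1 - TensorProduct.map e e' := by
    calc _ = TensorProduct.map (C.dEnd * h + h * C.dEnd) 1 +
          TensorProduct.map (C.dEnd * e + e * C.dEnd) h' +
          TensorProduct.map (C.sign * h + h * C.sign) C'.dEnd +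
          (TensorProduct.map (C.sign * e) (C'.dEnd * h') +
            TensorProduct.map (e * C.sign) (h' * C'.dEnd)) := by
          simp only [tensorD, add_mul, mul_add, ← TensorProduct.map_mul, one_mul, mul_one,
            TensorProduct.map_add_left]
          abel
      _ = TensorProduct.map (1 - e) 1 + TensorProduct.map e (1 - e') := by
          rw [hh, hde, hs, hse, hes, ← TensorProduct.map_add_right, hh',
            TensorProduct.map_zero_left, TensorProduct.map_zero_left, add_zero, add_zero]
      _ = 1 - TensorProduct.map e e' := by
          rw [eq_sub_iff_add_eq, add_assoc, ← TensorProduct.map_add_right, sub_add_cancel,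
            ← TensorProduct.map_add_left, sub_add_cancel]
          exact TensorProduct.map_one
  have he : TensorProduct.map e e' z = 0 := by
    change TensorProduct.map (t ∘ₗ C.aug) (t' ∘ₗ C'.aug) z = 0
    rw [TensorProduct.map_comp, LinearMap.comp_apply, ha, map_zero]
  refine ⟨(TensorProduct.map h 1 + TensorProduct.map e h' : Module.End K (V ⊗[K] V')) z, ?_⟩
  have := LinearMap.congr_fun key z
  rw [LinearMap.add_apply, Module.End.mul_apply, Module.End.mul_apply, hd, map_zero, add_zero,
    LinearMap.sub_apply, he, sub_zero] at this
  exact this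

end AugmentedComplex

/-! ### Tensor products of resolutions over disjoint sets of variables. -/

namespace TotalResolution

variable {σ K : Type*} [Field K] {I : Ideal (MvPolynomial σ K)} (T : TotalResolution I)

/-- The projection onto the span of the generators with a given property. -/
def proj (P : T.gen → Prop) [DecidablePred P] :
    (T.gen →₀ MvPolynomial σ K) →ₗ[MvPolynomial σ K] (T.gen →₀ MvPolynomial σ K) where
  toFun := Finsupp.filter P
  map_add' := fun _ _ => Finsupp.filter_add
  map_smul' := fun _ _ => Finsupp.filter_smul

lemma proj_apply (P : T.gen → Prop) [DecidablePred P] (y : T.gen →₀ MvPolynomial σ K) (g : T.gen) :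
    T.proj P y g = if P g then y g else 0 := Finsupp.filter_apply P y g

lemma proj_single (P : T.gen → Prop) [DecidablePred P] (g : T.gen) (f : MvPolynomial σ K) :
    T.proj P (Finsupp.single g f) = if P g then Finsupp.single g f else 0 := by
  split_ifs with h
  · exact Finsupp.filter_single_of_pos _ h
  · exact Finsupp.filter_single_of_neg _ h

lemma linearMap_ext_single {M : Type*} [AddCommGroup M] [Module (MvPolynomial σ K) M]
    {f g : (T.gen →₀ MvPolynomial σ K) →ₗ[MvPolynomial σ K] M}
    (h : ∀ b, f (Finsupp.single b 1) = g (Finsupp.single b 1)) : f = g := by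
  refine Finsupp.lhom_ext fun b a => ?_
  rw [← mul_one a, ← smul_eq_mul, ← Finsupp.smul_single, map_smul, map_smul, h]

lemma proj_even_d (y : T.gen →₀ MvPolynomial σ K) :
    T.proj (fun g => Even (T.hdeg g)) (T.d y) + T.d (T.proj (fun g => Even (T.hdeg g)) y) =
      T.d y := by
  have h : T.proj (fun g => Even (T.hdeg g)) ∘ₗ T.d + T.d ∘ₗ T.proj (fun g => Even (T.hdeg g)) =
      T.d := by
    refine T.linearMap_ext_single fun b => ?_
    rw [LinearMap.add_apply, LinearMap.comp_apply, LinearMap.comp_apply, proj_single]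
    ext1 c
    rw [Finsupp.add_apply, proj_apply]
    by_cases hc : T.d (Finsupp.single b 1) c = 0
    · split_ifs <;> simp [hc]
    · have := T.hdeg_of_ne b c hc
      rw [← this]
      by_cases he : Even (T.hdeg c) <;> simp [he, Nat.even_add_one]
  exact LinearMap.congr_fun h y

lemma aug_proj (P : T.gen → Prop) [DecidablePred P] (hP : ∀ g, T.hdeg g = 0 → P g)
    (y : T.gen →₀ MvPolynomial σ K) : T.aug (T.proj P y) = T.aug y := by
  have h : T.aug ∘ₗ T.proj P = T.aug := by
    refine T.linearMap_ext_single fun b => ?_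
    rw [LinearMap.comp_apply, proj_single]
    split_ifs with hb
    · rfl
    · rw [map_zero, T.aug_eq_zero b fun h => hb (hP b h)]
  exact LinearMap.congr_fun h y

lemma d_proj_zero (y : T.gen →₀ MvPolynomial σ K) :
    T.d (T.proj (fun g => T.hdeg g = 0) y) = 0 := by
  have h : T.d ∘ₗ T.proj (fun g => T.hdeg g = 0) = 0 := by
    refine T.linearMap_ext_single fun b => ?_
    rw [LinearMap.comp_apply, proj_single, LinearMap.zero_apply]
    split_ifs with hb
    · ext1 c
      by_contra h
      have := T.hdeg_of_ne b c h
      omega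
    · rw [map_zero]
  exact LinearMap.congr_fun h y

/-- A resolution as a complex of vector spaces. -/
def toAugmentedComplex :
    AugmentedComplex K (T.gen →₀ MvPolynomial σ K) (MvPolynomial σ K) where
  d := T.d.restrictScalars K
  aug := T.aug.restrictScalars K
  even := (T.proj (fun g => Even (T.hdeg g))).restrictScalars K
  zero := (T.proj (fun g => T.hdeg g = 0)).restrictScalars K
  even_d := T.proj_even_d
  even_even := fun y => by
    ext1 g
    change T.proj _ (T.proj _ y) g = T.proj _ y g
    rw [proj_apply, proj_apply]
    split_ifs <;> rfl
  even_zero := fun y => by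
    ext1 g
    change T.proj _ (T.proj _ y) g = T.proj _ y g
    rw [proj_apply, proj_apply]
    by_cases h : T.hdeg g = 0 <;> simp [h]
  aug_even := T.aug_proj _ fun g h => by simp [h]
  aug_zero := T.aug_proj _ fun g h => h
  d_zero := T.d_proj_zero
  aug_d := T.aug_d
  d_d := T.d_d
  exact := T.exact

lemma sign_single (g : T.gen) (f : MvPolynomial σ K) :
    T.toAugmentedComplex.sign (Finsupp.single g f) =
      if Even (T.hdeg g) then Finsupp.single g f else -Finsupp.single g f := by
  rw [AugmentedComplex.sign_apply]
  change T.proj _ (Finsupp.single g f) + T.proj _ (Finsupp.single g f) - Finsupp.single g f = _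
  rw [proj_single]
  split_ifs <;> simp

end TotalResolution

/-- The tensor product of polynomial rings, with a choice of names for the variables. -/
def MvPolynomial.tensorEquivOfSum (K : Type*) [Field K] {σ τ ρ : Type*} (ε : σ ⊕ τ ≃ ρ) :
    MvPolynomial σ K ⊗[K] MvPolynomial τ K ≃ₐ[K] MvPolynomial ρ K :=
  (tensorEquivSum K σ τ K).trans (renameEquiv K ε)

lemma MvPolynomial.tensorEquivOfSum_tmul {K : Type*} [Field K] {σ τ ρ : Type*} (ε : σ ⊕ τ ≃ ρ)
    (f : MvPolynomial σ K) (g : MvPolynomial τ K) :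
    tensorEquivOfSum K ε (f ⊗ₜ g) = rename (ε ∘ Sum.inl) f * rename (ε ∘ Sum.inr) g := by
  have h1 : (tensorEquivOfSum K ε).toAlgHom.comp Algebra.TensorProduct.includeLeft =
      rename (ε ∘ Sum.inl) := by
    refine algHom_ext fun i => ?_
    simp [tensorEquivOfSum]
  have h2 : (tensorEquivOfSum K ε).toAlgHom.comp Algebra.TensorProduct.includeRight =
      rename (ε ∘ Sum.inr) := by
    refine algHom_ext fun i => ?_
    simp [tensorEquivOfSum]
  rw [← h1, ← h2, ← mul_one f, ← one_mul g, ← Algebra.TensorProduct.tmul_mul_tmul, map_mul, mul_one,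
    one_mul]
  rfl

namespace TotalResolution

variable {σ τ ρ K : Type*} [Field K] {I : Ideal (MvPolynomial σ K)} {I' : Ideal (MvPolynomial τ K)}
  (T : TotalResolution I) (T' : TotalResolution I') (ε : σ ⊕ τ ≃ ρ)

/-- The tensor product of two free modules over different polynomial rings as a free module. -/
def tensorEquiv : (T.gen →₀ MvPolynomial σ K) ⊗[K] (T'.gen →₀ MvPolynomial τ K) ≃ₗ[K]
    (T.gen × T'.gen →₀ MvPolynomial ρ K) :=
  finsuppTensorFinsupp K K _ _ _ _ ≪≫ₗ
    Finsupp.mapRange.linearEquiv (tensorEquivOfSum K ε).toLinearEquiv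

lemma tensorEquiv_tmul_apply (u : T.gen →₀ MvPolynomial σ K) (v : T'.gen →₀ MvPolynomial τ K)
    (c : T.gen × T'.gen) : tensorEquiv T T' ε (u ⊗ₜ v) c =
      rename (ε ∘ Sum.inl) (u c.1) * rename (ε ∘ Sum.inr) (v c.2) := by
  rw [← tensorEquivOfSum_tmul]
  change tensorEquivOfSum K ε (finsuppTensorFinsupp K K _ _ _ _ (u ⊗ₜ v) (c.1, c.2)) = _
  rw [finsuppTensorFinsupp_apply]

/-- Links the tensor product over `K` with linearity over the large polynomial ring: agreement on
basis elements extends to polynomial coefficients. -/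
lemma tensorEquiv_smul_tmul_smul (f : MvPolynomial σ K) (f' : MvPolynomial τ K)
    (u : T.gen →₀ MvPolynomial σ K) (v : T'.gen →₀ MvPolynomial τ K) :
    tensorEquiv T T' ε ((f • u) ⊗ₜ (f' • v)) =
      (rename (ε ∘ Sum.inl) f * rename (ε ∘ Sum.inr) f') • tensorEquiv T T' ε (u ⊗ₜ v) := by
  refine Finsupp.ext fun c => ?_
  rw [Finsupp.smul_apply, tensorEquiv_tmul_apply, tensorEquiv_tmul_apply, Finsupp.smul_apply,
    Finsupp.smul_apply, smul_eq_mul, smul_eq_mul, smul_eq_mul, map_mul, map_mul]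
  ring

lemma tensorEquiv_single_tmul_single (g : T.gen) (g' : T'.gen) (f : MvPolynomial σ K)
    (f' : MvPolynomial τ K) :
    tensorEquiv T T' ε (Finsupp.single g f ⊗ₜ Finsupp.single g' f') =
      Finsupp.single (g, g') (rename (ε ∘ Sum.inl) f * rename (ε ∘ Sum.inr) f') := by
  rw [← tensorEquivOfSum_tmul, tensorEquiv, LinearEquiv.trans_apply, finsuppTensorFinsupp_single,
    Finsupp.mapRange.linearEquiv_apply]
  exact Finsupp.mapRange_single

lemma tensor_induction {p : (T.gen →₀ MvPolynomial σ K) ⊗[K] (T'.gen →₀ MvPolynomial τ K) → Prop}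
    (hadd : ∀ x y, p x → p y → p (x + y)) (hzero : p 0)
    (hsingle : ∀ g f g' f', p (Finsupp.single g f ⊗ₜ Finsupp.single g' f')) (z) : p z := by
  induction z using TensorProduct.induction_on with
  | zero => exact hzero
  | add x y hx hy => exact hadd x y hx hy
  | tmul u v =>
    induction u using Finsupp.induction_linear with
    | zero => rwa [TensorProduct.zero_tmul]
    | add x y hx hy => rw [TensorProduct.add_tmul]; exact hadd _ _ hx hy
    | single g f =>
      induction v using Finsupp.induction_linear with
      | zero => rwa [TensorProduct.tmul_zero]
      | add x y hx hy => rw [TensorProduct.tmul_add]; exact hadd _ _ hx hy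
      | single g' f' => exact hsingle g f g' f'

/-- The differential of the tensor product on the basis. -/
def tensorCol (g : T.gen × T'.gen) : T.gen × T'.gen →₀ MvPolynomial ρ K :=
  tensorEquiv T T' ε (T.toAugmentedComplex.tensorD T'.toAugmentedComplex
    (Finsupp.single g.1 1 ⊗ₜ Finsupp.single g.2 1))

/-- The differential of the tensor product. -/
def tensorD : (T.gen × T'.gen →₀ MvPolynomial ρ K) →ₗ[MvPolynomial ρ K]
    (T.gen × T'.gen →₀ MvPolynomial ρ K) :=
  Finsupp.linearCombination _ (tensorCol T T' ε)

/-- The augmentation of the tensor product on the basis. -/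
def tensorAugCol (g : T.gen × T'.gen) : MvPolynomial ρ K :=
  rename (ε ∘ Sum.inl) (T.aug (Finsupp.single g.1 1)) *
    rename (ε ∘ Sum.inr) (T'.aug (Finsupp.single g.2 1))

/-- The augmentation of the tensor product. -/
def tensorAug : (T.gen × T'.gen →₀ MvPolynomial ρ K) →ₗ[MvPolynomial ρ K] MvPolynomial ρ K :=
  Finsupp.linearCombination _ (tensorAugCol T T' ε)

lemma sign_single_eq_smul (g : T.gen) (f : MvPolynomial σ K) :
    T.toAugmentedComplex.sign (Finsupp.single g f) =
      f • T.toAugmentedComplex.sign (Finsupp.single g 1) := by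
  rw [sign_single, sign_single]
  split_ifs <;> simp

/-- Identifies the differential defined linearly on a basis with the one of the tensor product over
`K`, so that `d² = 0` and exactness carry over. -/
lemma tensorD_tensorEquiv (z) : tensorD T T' ε (tensorEquiv T T' ε z) =
    tensorEquiv T T' ε (T.toAugmentedComplex.tensorD T'.toAugmentedComplex z) := by
  induction z using tensor_induction with
  | hzero => simp
  | hadd x y hx hy => simp only [map_add, hx, hy]
  | hsingle g f g' f' =>
    have h1 : T.toAugmentedComplex.d (Finsupp.single g f) =
        f • T.toAugmentedComplex.d (Finsupp.single g 1) := T.d_single g f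
    have h2 : T'.toAugmentedComplex.d (Finsupp.single g' f') =
        f' • T'.toAugmentedComplex.d (Finsupp.single g' 1) := T'.d_single g' f'
    have h4 : (Finsupp.single g' f' : T'.gen →₀ MvPolynomial τ K) = f' • Finsupp.single g' 1 := by
      simp
    rw [tensorEquiv_single_tmul_single, tensorD, Finsupp.linearCombination_single, tensorCol,
      AugmentedComplex.tensorD_tmul, AugmentedComplex.tensorD_tmul, h1, h2,
      T.sign_single_eq_smul g f, h4, map_add, map_add, tensorEquiv_smul_tmul_smul,
      tensorEquiv_smul_tmul_smul, smul_add]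

lemma tensorAug_tensorEquiv (z) : tensorAug T T' ε (tensorEquiv T T' ε z) =
    tensorEquivOfSum K ε
      (TensorProduct.map T.toAugmentedComplex.aug T'.toAugmentedComplex.aug z) := by
  induction z using tensor_induction with
  | hzero => simp
  | hadd x y hx hy => simp only [map_add, hx, hy]
  | hsingle g f g' f' =>
    have h1 : T.toAugmentedComplex.aug (Finsupp.single g f) =
        f * T.aug (Finsupp.single g 1) := T.aug_single g f
    have h2 : T'.toAugmentedComplex.aug (Finsupp.single g' f') =
        f' * T'.aug (Finsupp.single g' 1) := T'.aug_single g' f'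
    rw [tensorEquiv_single_tmul_single, tensorAug, Finsupp.linearCombination_single, tensorAugCol,
      TensorProduct.map_tmul, tensorEquivOfSum_tmul, h1, h2, map_mul, map_mul, smul_eq_mul]
    ring

lemma ideal_eq_span : I = Ideal.span (Set.range fun g => T.aug (Finsupp.single g 1)) := by
  conv_lhs => rw [← T.range_aug]
  have h : T.aug = Finsupp.linearCombination _ fun g => T.aug (Finsupp.single g 1) := by
    refine T.linearMap_ext_single fun b => ?_
    rw [Finsupp.linearCombination_single, one_smul]
  conv_lhs => rw [h, Finsupp.range_linearCombination]

lemma tensorCol_apply (g c : T.gen × T'.gen) : tensorCol T T' ε g c =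
    rename (ε ∘ Sum.inl) (T.d (Finsupp.single g.1 1) c.1) *
        rename (ε ∘ Sum.inr) (Finsupp.single (M := MvPolynomial τ K) g.2 1 c.2) +
      rename (ε ∘ Sum.inl) (T.toAugmentedComplex.sign (Finsupp.single g.1 1) c.1) *
        rename (ε ∘ Sum.inr) (T'.d (Finsupp.single g.2 1) c.2) := by
  rw [tensorCol, AugmentedComplex.tensorD_tmul, map_add, Finsupp.add_apply, tensorEquiv_tmul_apply,
    tensorEquiv_tmul_apply]
  rfl

lemma eq_of_sign_single_ne {g c : T.gen}
    (h : T.toAugmentedComplex.sign (Finsupp.single g 1) c ≠ 0) : g = c := by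
  by_contra hne
  apply h
  rw [sign_single]
  split_ifs <;> simp [Finsupp.single_eq_of_ne' hne]

lemma isHomogVec_single (g : T.gen) :
    IsHomogVec T.ddeg (T.ddeg g) (Finsupp.single (M := MvPolynomial σ K) g 1) := by
  classical
  intro c m hm
  by_cases h : g = c
  · subst h
    rw [Finsupp.single_eq_same, mem_support_iff, coeff_one] at hm
    have h0 : 0 = m := by by_contra h; exact hm (if_neg h)
    simp [← h0]
  · rw [Finsupp.single_eq_of_ne' h] at hm
    simp at hm

lemma isHomogVec_sign_single (g : T.gen) :
    IsHomogVec T.ddeg (T.ddeg g) (T.toAugmentedComplex.sign (Finsupp.single g 1)) := by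
  intro c m hm
  refine T.isHomogVec_single g c m ?_
  rw [sign_single] at hm
  split_ifs at hm with h
  · exact hm
  · rwa [Finsupp.neg_apply, support_neg] at hm

lemma degree_of_mem_support_mul_rename {f : MvPolynomial σ K} {f' : MvPolynomial τ K}
    {a n a' n' : ℕ} (hf : ∀ m ∈ f.support, m.degree + a = n)
    (hf' : ∀ m ∈ f'.support, m.degree + a' = n') (φ : σ → ρ) (ψ : τ → ρ) :
    ∀ m ∈ (rename φ f * rename ψ f').support, m.degree + (a + a') = n + n' := by
  classical
  intro m hm
  obtain ⟨m₁, h₁, m₂, h₂, rfl⟩ := Finset.mem_add.1 (support_mul _ _ hm)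
  obtain ⟨u₁, rfl, hu₁⟩ := coeff_rename_ne_zero _ _ _ (mem_support_iff.1 h₁)
  obtain ⟨u₂, rfl, hu₂⟩ := coeff_rename_ne_zero _ _ _ (mem_support_iff.1 h₂)
  rw [map_add, Finsupp.degree_mapDomain, Finsupp.degree_mapDomain, ← hf u₁ (mem_support_iff.2 hu₁),
    ← hf' u₂ (mem_support_iff.2 hu₂)]
  omega

lemma finite_hdeg_prod (i : ℕ) :
    Finite {g : T.gen × T'.gen // T.hdeg g.1 + T'.hdeg g.2 = i} := by
  have h1 := T.finite_hdeg
  have h2 := T'.finite_hdeg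
  -- Both homological degrees are at most `i`, so finitely many pairs of degrees occur.
  refine Finite.of_surjective
    (α := Σ j : Fin (i + 1) × Fin (i + 1), {p : {g // T.hdeg g = j.1} × {g // T'.hdeg g = j.2} //
      T.hdeg p.1 + T'.hdeg p.2 = i})
    (fun p => ⟨(p.2.1.1.1, p.2.1.2.1), p.2.2⟩) ?_
  rintro ⟨⟨g, g'⟩, h⟩
  exact ⟨⟨(⟨T.hdeg g, by dsimp at h; omega⟩, ⟨T'.hdeg g', by dsimp at h; omega⟩),
    ⟨(⟨g, rfl⟩, ⟨g', rfl⟩), h⟩⟩, rfl⟩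

/-- The tensor product of minimal resolutions over polynomial rings in disjoint sets of variables
resolves the product of the ideals. -/
def tensor : TotalResolution (I.map (rename (R := K) (ε ∘ Sum.inl)) *
    I'.map (rename (R := K) (ε ∘ Sum.inr))) where
  gen := T.gen × T'.gen
  hdeg := fun g => T.hdeg g.1 + T'.hdeg g.2
  ddeg := fun g => T.ddeg g.1 + T'.ddeg g.2
  finite_hdeg := finite_hdeg_prod T T'
  d := tensorD T T' ε
  aug := tensorAug T T' ε
  hdeg_of_ne := by
    intro g c h
    rw [tensorD, Finsupp.linearCombination_single, one_smul, tensorCol_apply] at h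
    -- One of the two summands is nonzero; in it one factor drops by one homological degree and the
    -- other generator stays the same.
    by_cases h' : rename (ε ∘ Sum.inl) (T.d (Finsupp.single g.1 1) c.1) *
        rename (ε ∘ Sum.inr) (Finsupp.single (M := MvPolynomial τ K) g.2 1 c.2) = 0
    · rw [h', zero_add] at h
      have h1 := T.eq_of_sign_single_ne fun e => h (by rw [e, map_zero, zero_mul])
      have h2 := T'.hdeg_of_ne g.2 c.2 fun e => h (by rw [e, map_zero, mul_zero])
      rw [h1]
      omega
    · have h1 := T.hdeg_of_ne g.1 c.1 fun e => h' (by rw [e, map_zero, zero_mul])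
      have h2 : g.2 = c.2 := by
        by_contra hne
        exact h' (by rw [Finsupp.single_eq_of_ne' hne, map_zero, mul_zero])
      rw [h2]
      omega
  d_homogeneous := by
    classical
    intro g c m hm
    rw [tensorD, Finsupp.linearCombination_single, one_smul, tensorCol_apply] at hm
    rcases Finset.mem_union.1 (support_add hm) with hm | hm
    · exact degree_of_mem_support_mul_rename (T.d_homogeneous g.1 c.1)
        (T'.isHomogVec_single g.2 c.2) _ _ m hm
    · exact degree_of_mem_support_mul_rename (T.isHomogVec_sign_single g.1 c.1)
        (T'.d_homogeneous g.2 c.2) _ _ m hm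
  d_minimal := by
    intro g c
    rw [tensorD, Finsupp.linearCombination_single, one_smul, tensorCol_apply, map_add, map_mul,
      map_mul, constantCoeff_rename, constantCoeff_rename, constantCoeff_rename,
      constantCoeff_rename, T.d_minimal, T'.d_minimal, zero_mul, mul_zero, add_zero]
  aug_eq_zero := by
    intro g h
    rw [tensorAug, Finsupp.linearCombination_single, one_smul, tensorAugCol]
    by_cases h1 : T.hdeg g.1 = 0
    · rw [T'.aug_eq_zero g.2 (by omega), map_zero, mul_zero]
    · rw [T.aug_eq_zero g.1 h1, map_zero, zero_mul]
  aug_homogeneous := by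
    intro g
    rw [tensorAug, Finsupp.linearCombination_single, one_smul, tensorAugCol]
    exact (T.aug_homogeneous g.1).rename_isHomogeneous.mul
      (T'.aug_homogeneous g.2).rename_isHomogeneous
  range_aug := by
    conv_rhs => rw [T.ideal_eq_span, T'.ideal_eq_span]
    rw [Ideal.map_span, Ideal.map_span, Ideal.span_mul_span', tensorAug,
      Finsupp.range_linearCombination]
    congr 1
    ext x
    rw [Set.mem_mul]
    constructor
    · rintro ⟨g, rfl⟩
      exact ⟨_, ⟨_, ⟨g.1, rfl⟩, rfl⟩, _, ⟨_, ⟨g.2, rfl⟩, rfl⟩, rfl⟩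
    · rintro ⟨_, ⟨_, ⟨g, rfl⟩, rfl⟩, _, ⟨_, ⟨g', rfl⟩, rfl⟩, rfl⟩
      exact ⟨(g, g'), rfl⟩
  aug_d := by
    intro z
    obtain ⟨u, rfl⟩ := (tensorEquiv T T' ε).surjective z
    rw [tensorD_tensorEquiv, tensorAug_tensorEquiv, AugmentedComplex.aug_tensorD, map_zero]
  d_d := by
    intro z
    obtain ⟨u, rfl⟩ := (tensorEquiv T T' ε).surjective z
    rw [tensorD_tensorEquiv, tensorD_tensorEquiv, AugmentedComplex.tensorD_tensorD, map_zero]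
  exact := by
    intro z hd ha
    obtain ⟨u, rfl⟩ := (tensorEquiv T T' ε).surjective z
    rw [tensorD_tensorEquiv, LinearEquiv.map_eq_zero_iff] at hd
    rw [tensorAug_tensorEquiv, map_eq_zero_iff _ (tensorEquivOfSum K ε).injective] at ha
    obtain ⟨y, rfl⟩ := AugmentedComplex.tensorD_exact _ _ u hd ha
    exact ⟨_, tensorD_tensorEquiv T T' ε y⟩

lemma bideg_tensor (g : T.gen × T'.gen) :
    (tensor T T' ε).bideg g = T.bideg g.1 + T'.bideg g.2 := by
  change Finsupp.single 0 (T.hdeg g.1 + T'.hdeg g.2) +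
    Finsupp.single 1 (T.ddeg g.1 + T'.ddeg g.2) = _
  rw [Finsupp.single_add, Finsupp.single_add, bideg, bideg]
  abel

end TotalResolution

/-! ### Multiplicativity of the Betti series. -/

/-- The number of pairs with a given sum of weights. -/
lemma natCard_prod_weight_eq_sum {α β M : Type*} [AddCommMonoid M] [Finset.HasAntidiagonal M]
    (f : α → M) (g : β → M) (hf : ∀ m, Finite {a // f a = m}) (hg : ∀ m, Finite {b // g b = m})
    (m : M) : Nat.card {x : α × β // f x.1 + g x.2 = m} =
      ∑ p ∈ Finset.HasAntidiagonal.antidiagonal m,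
        Nat.card {a // f a = p.1} * Nat.card {b // g b = p.2} := by
  let e : {x : α × β // f x.1 + g x.2 = m} ≃
      Σ p : Finset.HasAntidiagonal.antidiagonal m, {a // f a = p.1.1} × {b // g b = p.1.2} :=
    { toFun := fun x => ⟨⟨(f x.1.1, g x.1.2), Finset.HasAntidiagonal.mem_antidiagonal.2 x.2⟩,
        ⟨x.1.1, rfl⟩, ⟨x.1.2, rfl⟩⟩
      invFun := fun y => ⟨(y.2.1.1, y.2.2.1), by
        rw [y.2.1.2, y.2.2.2]
        exact Finset.HasAntidiagonal.mem_antidiagonal.1 y.1.2⟩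
      left_inv := fun _ => rfl
      right_inv := by
        rintro ⟨⟨⟨p, q⟩, h⟩, ⟨a, ha⟩, ⟨b, hb⟩⟩
        dsimp only at ha hb
        subst ha hb
        rfl }
  rw [Nat.card_congr e, Nat.card_sigma]
  simp_rw [Nat.card_prod]
  exact Finset.sum_coe_sort (Finset.HasAntidiagonal.antidiagonal m)
    fun p => Nat.card {a // f a = p.1} * Nat.card {b // g b = p.2}

/-- The Betti series of the product of two ideals in disjoint sets of variables. -/
theorem bettiSeries_mul {σ τ ρ K : Type*} [Finite σ] [Finite τ] [Finite ρ] [Field K]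
    {I : Ideal (MvPolynomial σ K)} (hI : I.IsHomogeneous (homogeneousSubmodule σ K))
    {I' : Ideal (MvPolynomial τ K)} (hI' : I'.IsHomogeneous (homogeneousSubmodule τ K))
    {J : Ideal (MvPolynomial ρ K)} (hJ : J.IsHomogeneous (homogeneousSubmodule ρ K))
    (ε : σ ⊕ τ ≃ ρ) (h : J = I.map (rename (R := K) (ε ∘ Sum.inl)) *
      I'.map (rename (R := K) (ε ∘ Sum.inr))) :
    bettiSeries J hJ = bettiSeries I hI * bettiSeries I' hI' := by
  classical
  subst h
  obtain ⟨F, hF⟩ := GradedFreeResolution.exists_isMinimal I hI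
  obtain ⟨F', hF'⟩ := GradedFreeResolution.exists_isMinimal I' hI'
  let T := F.toTotalResolution hF
  let T' := F'.toTotalResolution hF'
  ext m
  rw [(T.tensor T' ε).coeff_bettiSeries, MvPowerSeries.coeff_mul]
  change (Nat.card {g : T.gen × T'.gen // (T.tensor T' ε).bideg g = m} : ℤ) = _
  simp_rw [T.coeff_bettiSeries, T'.coeff_bettiSeries, T.bideg_tensor T' ε]
  have := natCard_prod_weight_eq_sum T.bideg T'.bideg T.finite_bideg T'.finite_bideg m
  exact_mod_cast this

/-- The minimal resolution of the unit ideal. -/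
def TotalResolution.ofTop (σ K : Type*) [Field K] :
    TotalResolution (⊤ : Ideal (MvPolynomial σ K)) where
  gen := Unit
  hdeg := fun _ => 0
  ddeg := fun _ => 0
  finite_hdeg := fun _ => inferInstance
  d := 0
  aug := Finsupp.lapply ()
  hdeg_of_ne := fun _ _ h => absurd rfl h
  d_homogeneous := fun _ _ _ hm => absurd hm (by simp)
  d_minimal := fun _ _ => map_zero _
  aug_eq_zero := fun _ h => absurd rfl h
  aug_homogeneous := fun _ => by
    rw [Finsupp.lapply_apply, Finsupp.single_eq_same]
    exact isHomogeneous_one _ _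
  range_aug := by
    rw [LinearMap.range_eq_top]
    exact fun x => ⟨Finsupp.single () x, Finsupp.single_eq_same⟩
  aug_d := fun _ => rfl
  d_d := fun _ => rfl
  exact := fun z _ h => ⟨0, (Finsupp.ext fun _ => h.symm)⟩

lemma bettiSeries_top (σ K : Type*) [Finite σ] [Field K]
    (h : (⊤ : Ideal (MvPolynomial σ K)).IsHomogeneous (homogeneousSubmodule σ K)) :
    bettiSeries (⊤ : Ideal (MvPolynomial σ K)) h = 1 := by
  classical
  ext m
  rw [(TotalResolution.ofTop σ K).coeff_bettiSeries, MvPowerSeries.coeff_one]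
  have hb : ∀ g, (TotalResolution.ofTop σ K).bideg g = 0 := fun g => by
    simp [TotalResolution.bideg, TotalResolution.ofTop]
  simp_rw [hb]
  split_ifs with hm
  · subst hm
    have : Nat.card {_g : Unit // (0 : Fin 2 →₀ ℕ) = 0} = 1 := by simp
    exact_mod_cast this
  · have : IsEmpty {_g : (TotalResolution.ofTop σ K).gen // 0 = m} := ⟨fun g => hm g.2.symm⟩
    rw [Nat.card_of_isEmpty, Nat.cast_zero]

/-! ### Cuts and factorization of cut monomials. -/

/-- An edge joins a vertex in `S` and a vertex outside of `S`. -/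
def Sym2.IsCut {V : Type*} (S : Set V) (e : Sym2 V) : Prop :=
  (∃ v ∈ e, v ∈ S) ∧ (∃ w ∈ e, w ∉ S)

lemma Sym2.isCut_congr {V : Type*} {S T : Set V} {e : Sym2 V} (h : ∀ v ∈ e, v ∈ S ↔ v ∈ T) :
    e.IsCut S ↔ e.IsCut T :=
  and_congr (exists_congr fun v => and_congr_right fun hv => h v hv)
    (exists_congr fun v => and_congr_right fun hv => not_congr (h v hv))

lemma Sym2.isCut_compl {V : Type*} (S : Set V) (e : Sym2 V) : e.IsCut Sᶜ ↔ e.IsCut S := by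
  simp [Sym2.IsCut, and_comm]

lemma Sym2.isCut_map {V W : Type*} (f : V → W) (S : Set W) (e : Sym2 V) :
    (e.map f).IsCut S ↔ e.IsCut (f ⁻¹' S) := by
  simp [Sym2.IsCut, Sym2.mem_map]

open scoped Classical in
lemma cutMonomial_eq_prod (K : Type*) [Field K] {V : Type*} (G : SimpleGraph V) [Fintype G.edgeSet]
    (S : Set V) : cutMonomial K G S =
      ∏ e : G.edgeSet, if e.1.IsCut S then X (Sum.inl e) else X (Sum.inr e) := by
  simp only [cutMonomial]
  rw [finprod_eq_prod_of_fintype]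
  exact Finset.prod_congr rfl fun e _ => if_congr Iff.rfl rfl rfl

/-- Without edges every cut monomial is the empty product, so the cut ideal is the unit ideal. -/
lemma cutBettiSeries_eq_one (K : Type*) [Field K] {V : Type*} [Finite V] (G : SimpleGraph V)
    [IsEmpty G.edgeSet] : cutBettiSeries K G = 1 := by
  have h : cutIdeal K G = ⊤ := by
    rw [Ideal.eq_top_iff_one]
    refine Ideal.subset_span ⟨∅, ?_⟩
    simp only [cutMonomial]
    exact finprod_of_isEmpty _
  -- Stated for a variable ideal because the homogeneity proof depends on it, which blocks direct
  -- rewriting.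
  have key : ∀ (I : Ideal (MvPolynomial (G.edgeSet ⊕ G.edgeSet) K))
      (hI : I.IsHomogeneous (homogeneousSubmodule _ K)), I = ⊤ → bettiSeries I hI = 1 := by
    rintro I hI rfl
    exact bettiSeries_top _ _ _
  exact key _ _ h

/-- If the edges of `G` are the edges of `A` and of `B`, and the cuts of `G` are the pairs of cuts
of `A` and `B`, then the Betti series multiply. -/
theorem cutBettiSeries_eq_mul (K : Type*) [Field K] {V V₁ V₂ : Type*} [Finite V] [Finite V₁]
    [Finite V₂] {G : SimpleGraph V} {A : SimpleGraph V₁} {B : SimpleGraph V₂}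
    (e : A.edgeSet ⊕ B.edgeSet ≃ G.edgeSet)
    (h₁ : ∀ S : Set V, ∃ (S₁ : Set V₁) (S₂ : Set V₂),
      (∀ a, (e (Sum.inl a)).1.IsCut S ↔ a.1.IsCut S₁) ∧
      (∀ b, (e (Sum.inr b)).1.IsCut S ↔ b.1.IsCut S₂))
    (h₂ : ∀ (S₁ : Set V₁) (S₂ : Set V₂), ∃ S : Set V,
      (∀ a, (e (Sum.inl a)).1.IsCut S ↔ a.1.IsCut S₁) ∧
      (∀ b, (e (Sum.inr b)).1.IsCut S ↔ b.1.IsCut S₂)) :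
    cutBettiSeries K G = cutBettiSeries K A * cutBettiSeries K B := by
  classical
  have := Fintype.ofFinite G.edgeSet
  have := Fintype.ofFinite A.edgeSet
  have := Fintype.ofFinite B.edgeSet
  -- Regroups the variables from "by graph, then by type" to "by type", so that `s` goes to `s` and
  -- `t` to `t`.
  let ε : (A.edgeSet ⊕ A.edgeSet) ⊕ (B.edgeSet ⊕ B.edgeSet) ≃ G.edgeSet ⊕ G.edgeSet :=
    (Equiv.sumSumSumComm _ _ _ _).trans (Equiv.sumCongr e e)
  have hmon : ∀ (S : Set V) (S₁ : Set V₁) (S₂ : Set V₂),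
      (∀ a, (e (Sum.inl a)).1.IsCut S ↔ a.1.IsCut S₁) →
      (∀ b, (e (Sum.inr b)).1.IsCut S ↔ b.1.IsCut S₂) →
      cutMonomial K G S = rename (ε ∘ Sum.inl) (cutMonomial K A S₁) *
        rename (ε ∘ Sum.inr) (cutMonomial K B S₂) := by
    intro S S₁ S₂ ha hb
    rw [cutMonomial_eq_prod, cutMonomial_eq_prod, cutMonomial_eq_prod, map_prod, map_prod,
      ← e.prod_comp, Fintype.prod_sum_type]
    congr 1
    · refine Finset.prod_congr rfl fun a _ => ?_
      rw [apply_ite (rename (ε ∘ Sum.inl)), rename_X, rename_X]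
      exact if_congr (ha a) rfl rfl
    · refine Finset.prod_congr rfl fun b _ => ?_
      rw [apply_ite (rename (ε ∘ Sum.inr)), rename_X, rename_X]
      exact if_congr (hb b) rfl rfl
  refine bettiSeries_mul _ _ _ ε ?_
  rw [cutIdeal, cutIdeal, cutIdeal, Ideal.map_span, Ideal.map_span, Ideal.span_mul_span']
  congr 1
  ext x
  rw [Set.mem_mul]
  constructor
  · rintro ⟨S, rfl⟩
    obtain ⟨S₁, S₂, ha, hb⟩ := h₁ S
    exact ⟨_, ⟨_, ⟨S₁, rfl⟩, rfl⟩, _, ⟨_, ⟨S₂, rfl⟩, rfl⟩, (hmon S S₁ S₂ ha hb).symm⟩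
  · rintro ⟨_, ⟨_, ⟨S₁, rfl⟩, rfl⟩, _, ⟨_, ⟨S₂, rfl⟩, rfl⟩, rfl⟩
    obtain ⟨S, ha, hb⟩ := h₂ S₁ S₂
    exact ⟨S, hmon S S₁ S₂ ha hb⟩

/-! ### Gluing subgraphs along at most one vertex. -/

namespace SimpleGraph.Subgraph

variable {V : Type*} {G : SimpleGraph V}

/-- The edges of a subgraph, as edges of the subgraph viewed as a graph on its own vertices. -/
def coeEdgeSetEquiv (H : G.Subgraph) : H.coe.edgeSet ≃ H.edgeSet :=
  Equiv.ofBijective (fun e => ⟨e.1.map Subtype.val, by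
    obtain ⟨e, he⟩ := e
    induction e with | h u v => exact he⟩) (by
    constructor
    · intro e f h
      exact Subtype.ext (Sym2.map.injective Subtype.val_injective (congrArg Subtype.val h))
    · rintro ⟨e, he⟩
      induction e with
      | h u v =>
        have h : H.Adj u v := he
        exact ⟨⟨s(⟨u, h.fst_mem⟩, ⟨v, h.snd_mem⟩), h⟩, rfl⟩)

lemma isCut_iff (H : G.Subgraph) (e : H.coe.edgeSet) (S : Set V) :
    e.1.IsCut (Subtype.val ⁻¹' S) ↔ (H.coeEdgeSetEquiv e).1.IsCut S :=
  (Sym2.isCut_map _ _ _).symm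

lemma mem_verts_of_mem_of_mem_edgeSet (H : G.Subgraph) {e : Sym2 V} (he : e ∈ H.edgeSet) {v : V}
    (hv : v ∈ e) : v ∈ H.verts := by
  induction e with
  | h a b =>
    have h : H.Adj a b := he
    rcases Sym2.mem_iff.1 hv with rfl | rfl
    · exact h.fst_mem
    · exact h.snd_mem

/-- A common edge would provide two distinct common vertices. -/
lemma disjoint_edgeSet_of_encard_le_one {A B : G.Subgraph}
    (h : (A.verts ∩ B.verts).encard ≤ 1) : Disjoint A.edgeSet B.edgeSet := by
  rw [Set.disjoint_left]
  intro e ha hb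
  induction e with
  | h u v =>
    have hA : A.Adj u v := ha
    have hB : B.Adj u v := hb
    exact hA.ne (Set.encard_le_one_iff.1 h u v ⟨hA.fst_mem, hB.fst_mem⟩ ⟨hA.snd_mem, hB.snd_mem⟩)

/-- Two cuts of subgraphs with at most one common vertex come from one cut. -/
lemma exists_cut_of_encard_le_one {A B : G.Subgraph} (h : (A.verts ∩ B.verts).encard ≤ 1)
    (P Q : Set V) : ∃ S : Set V, (∀ e ∈ A.edgeSet, e.IsCut S ↔ e.IsCut P) ∧
      ∀ e ∈ B.edgeSet, e.IsCut S ↔ e.IsCut Q := by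
  obtain ⟨Q', hQ', hPQ⟩ : ∃ Q' : Set V, (∀ e : Sym2 V, e.IsCut Q' ↔ e.IsCut Q) ∧
      ∀ v ∈ A.verts ∩ B.verts, v ∈ P ↔ v ∈ Q' := by
    by_cases hx : ∀ v ∈ A.verts ∩ B.verts, v ∈ P ↔ v ∈ Q
    · exact ⟨Q, fun _ => Iff.rfl, hx⟩
    · push Not at hx
      obtain ⟨x, hx, hne⟩ := hx
      -- Complementing `Q` keeps its cut and repairs the disagreement at `x`, the only common
      -- vertex.
      refine ⟨Qᶜ, Sym2.isCut_compl Q, fun v hv => ?_⟩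
      obtain rfl := Set.encard_le_one_iff.1 h v x hv hx
      rw [Set.mem_compl_iff]
      tauto
  refine ⟨{v | v ∈ A.verts ∧ v ∈ P ∨ v ∈ B.verts ∧ v ∈ Q'}, fun e he => ?_, fun e he => ?_⟩
  · refine Sym2.isCut_congr fun v hv => ?_
    have hA := A.mem_verts_of_mem_of_mem_edgeSet he hv
    have := fun hB => hPQ v ⟨hA, hB⟩
    rw [Set.mem_ofPred_eq]
    tauto
  · rw [← hQ']
    refine Sym2.isCut_congr fun v hv => ?_
    have hB := B.mem_verts_of_mem_of_mem_edgeSet he hv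
    have := fun hA => hPQ v ⟨hA, hB⟩
    rw [Set.mem_ofPred_eq]
    tauto

open scoped Classical in
/-- The edges of the union of two subgraphs with at most one common vertex. -/
def supEdgeSetEquiv {A B : G.Subgraph} (h : (A.verts ∩ B.verts).encard ≤ 1) :
    A.coe.edgeSet ⊕ B.coe.edgeSet ≃ (A ⊔ B).coe.edgeSet :=
  (Equiv.sumCongr A.coeEdgeSetEquiv B.coeEdgeSetEquiv).trans
    ((Equiv.Set.union (disjoint_edgeSet_of_encard_le_one h)).symm.trans
      ((Equiv.setCongr edgeSet_sup.symm).trans (A ⊔ B).coeEdgeSetEquiv.symm))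

lemma cutBettiSeries_sup (K : Type*) [Field K] [Finite V] {A B : G.Subgraph}
    (h : (A.verts ∩ B.verts).encard ≤ 1) : cutBettiSeries K (A ⊔ B).coe =
      cutBettiSeries K A.coe * cutBettiSeries K B.coe := by
  have hl : ∀ (a : A.coe.edgeSet) (S : Set V),
      (supEdgeSetEquiv h (Sum.inl a)).1.IsCut (Subtype.val ⁻¹' S) ↔
        (A.coeEdgeSetEquiv a).1.IsCut S := by
    intro a S
    rw [isCut_iff]
    simp [supEdgeSetEquiv]
  have hr : ∀ (b : B.coe.edgeSet) (S : Set V),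
      (supEdgeSetEquiv h (Sum.inr b)).1.IsCut (Subtype.val ⁻¹' S) ↔
        (B.coeEdgeSetEquiv b).1.IsCut S := by
    intro b S
    rw [isCut_iff]
    simp [supEdgeSetEquiv]
  refine cutBettiSeries_eq_mul K (supEdgeSetEquiv h) (fun S => ?_) (fun S₁ S₂ => ?_)
  · obtain ⟨P, rfl⟩ : ∃ P : Set V, Subtype.val ⁻¹' P = S :=
      ⟨_, Set.preimage_image_eq _ Subtype.val_injective⟩
    exact ⟨Subtype.val ⁻¹' P, Subtype.val ⁻¹' P,
      fun a => (hl a P).trans (A.isCut_iff a P).symm, fun b => (hr b P).trans (B.isCut_iff b P).symm⟩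
  · obtain ⟨P, rfl⟩ : ∃ P : Set V, Subtype.val ⁻¹' P = S₁ :=
      ⟨_, Set.preimage_image_eq _ Subtype.val_injective⟩
    obtain ⟨Q, rfl⟩ : ∃ Q : Set V, Subtype.val ⁻¹' Q = S₂ :=
      ⟨_, Set.preimage_image_eq _ Subtype.val_injective⟩
    obtain ⟨S, hP, hQ⟩ := exists_cut_of_encard_le_one h P Q
    refine ⟨Subtype.val ⁻¹' S, fun a => ?_, fun b => ?_⟩
    · rw [hl, isCut_iff, hP _ (A.coeEdgeSetEquiv a).2]
    · rw [hr, isCut_iff, hQ _ (B.coeEdgeSetEquiv b).2]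

/-- The two graphs have different vertex types. The product formula with an edgeless second factor,
whose series is 1, transports the series along the bijection of edges. -/
lemma cutBettiSeries_top (K : Type*) [Field K] [Finite V] :
    cutBettiSeries K (⊤ : G.Subgraph).coe = cutBettiSeries K G := by
  have : IsEmpty (⊥ : SimpleGraph Empty).edgeSet := ⟨fun e => by simpa using e.2⟩
  rw [← mul_one (cutBettiSeries K G), ← cutBettiSeries_eq_one K (⊥ : SimpleGraph Empty)]
  let e : G.edgeSet ≃ (⊤ : G.Subgraph).coe.edgeSet :=
    (Equiv.setCongr edgeSet_top.symm).trans (⊤ : G.Subgraph).coeEdgeSetEquiv.symm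
  have he : ∀ (a : G.edgeSet) (S : Set V), (e a).1.IsCut (Subtype.val ⁻¹' S) ↔ a.1.IsCut S := by
    intro a S
    rw [isCut_iff]
    simp only [e, Equiv.trans_apply, Equiv.apply_symm_apply]
    rfl
  refine cutBettiSeries_eq_mul K ((Equiv.sumEmpty _ _).trans e) (fun S => ?_) (fun S _ => ?_)
  · obtain ⟨P, rfl⟩ : ∃ P : Set V, Subtype.val ⁻¹' P = S :=
      ⟨_, Set.preimage_image_eq _ Subtype.val_injective⟩
    exact ⟨P, ∅, fun a => he a P, isEmptyElim⟩
  · exact ⟨Subtype.val ⁻¹' S, fun a => he a S, isEmptyElim⟩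

/-- The last piece is split off: the hypothesis at the last index bounds its intersection with the
union of all earlier pieces. The empty union has no edges, hence series 1. -/
lemma cutBettiSeries_iSup (K : Type*) [Field K] [Finite V] (r : ℕ) (H : Fin r → G.Subgraph)
    (h : ∀ i, ((⋃ j, ⋃ _ : j < i, (H j).verts) ∩ (H i).verts).encard ≤ 1) :
    cutBettiSeries K (⨆ i, H i).coe = ∏ i, cutBettiSeries K (H i).coe := by
  induction r with
  | zero =>
    have : IsEmpty (⨆ i, H i).coe.edgeSet :=
      ⟨fun e => by simpa using ((⨆ i, H i).coeEdgeSetEquiv e).2⟩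
    rw [cutBettiSeries_eq_one, Finset.univ_eq_empty, Finset.prod_empty]
  | succ r ih =>
    have hsup : ⨆ i, H i = (⨆ i : Fin r, H i.castSucc) ⊔ H (Fin.last r) := by
      refine le_antisymm (iSup_le fun i => ?_)
        (sup_le (iSup_le fun i => le_iSup H _) (le_iSup H _))
      induction i using Fin.lastCases with
      | last => exact le_sup_right
      | cast i => exact (le_iSup (fun i : Fin r => H i.castSucc) i).trans le_sup_left
    rw [Fin.prod_univ_castSucc, ← ih (fun i => H i.castSucc) fun i => ?_, ← cutBettiSeries_sup K ?_]
    · rw [hsup]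
    · refine (Set.encard_le_encard ?_).trans (h (Fin.last r))
      rw [verts_iSup]
      refine Set.inter_subset_inter_left _ (Set.iUnion_subset fun i => ?_)
      exact Set.subset_iUnion₂_of_subset i.castSucc (Fin.castSucc_lt_last i) subset_rfl
    · refine (Set.encard_le_encard ?_).trans (h i.castSucc)
      refine Set.inter_subset_inter_left _ (Set.iUnion₂_subset fun j hj => ?_)
      exact Set.subset_iUnion₂_of_subset j.castSucc (Fin.castSucc_lt_castSucc_iff.2 hj) subset_rfl

end SimpleGraph.Subgraph

end

theorem corollary4p3 {K : Type*} [Field K] {V : Type*} [Finite V] (G : SimpleGraph V) (r : ℕ)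
    (H : Fin r → G.Subgraph) (hunion : ⨆ i, H i = ⊤)
    (hglue : ∀ i, ((⋃ j, ⋃ _ : j < i, (H j).verts) ∩ (H i).verts).encard ≤ 1) :
    cutBettiSeries K G = ∏ i, cutBettiSeries K (H i).coe := by
  rw [← SimpleGraph.Subgraph.cutBettiSeries_iSup K r H hglue, hunion,
    SimpleGraph.Subgraph.cutBettiSeries_top]
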